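/- \textbf{Setting.} Let $m\ge 1$, let $\mathcal H_1,\dots,\mathcal H_m$ be finite-dimensional real Hilbert spaces, and equip $\mathcal H_1\times\dots\times\mathcal H_m$ with the inner product $\langle \mathbf x,\mathbf y\rangle=\sum_i\langle x_i,y_i\rangle$. Let $S_i\subseteq\mathcal H_i$ be nonempty and closed, $S=S_1\times\dots\times S_m$, $h\colon\mathcal H_1\times\dots\times\mathcal H_m\to[-\infty,+\infty]$, $f_i,g_i\colon\mathcal H_i\to\mathbb R$, and consider $$\max_{\mathbf x\in S}F(\mathbf x),\qquad F(\mathbf x)=h(\mathbf x)+\sum_{i=1}^m\frac{f_i(x_i)}{g_i(x_i)}.$$ For an extended-real-valued function $\varphi$ put $\operatorname{dom}\varphi=\{\varphi<+\infty\}$; $\varphi$ is proper if $\operatorname{dom}\varphi\ne\varnothing$ and $\varphi>-\infty$ everywhere. At a point $x$ where $\varphi$ is finite, the Fréchet subdifferential is $\widehat\partial\varphi(x)=\{u:\liminf_{z\to x,\,z\ne x}\frac{\varphi(z)-\varphi(x)-\langle u,z-x\rangle}{\|z-x\|}\ge 0\}$ and the limiting subdifferential $\partial_L\varphi(x)$ is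 the set of limits $u=\lim_k u_k$ with $u_k\in\widehat\partial\varphi(x_k)$, $x_k\to x$, $\varphi(x_k)\to\varphi(x)$; both are empty where $\varphi$ is not finite. $\partial_L^{x_i}$ is the limiting subdifferential with respect to the $i$-th block, the other blocks being fixed. $\varphi$ is regular at $x$ if $\widehat\partial\varphi(x)=\partial_L\varphi(x)$; $\delta_C$ is the indicator function of $C$ ($0$ on $C$, $+\infty$ off $C$), and $C$ is regular if $\delta_C$ is regular at every point of $C$. A point $\overline{\mathbf x}\in S$ is a \emph{stationary point} if $0\in\partial_L(-F+\delta_S)(\overline{\mathbf x})$, and a \emph{lifted coordinate-wise stationary point} if, for each $i$, $$0\in\partial_L^{x_i}(-h+\delta_S)(\overline{\mathbf x})+\frac{-g_i(\overline x_i)\,\partial_Lf_i(\overline x_i)+f_i(\overline x_i)\,\partial_Lg_i(\overline x_i)}{g_i(\overline x_i)^2}.$$ \textbf{Assumption 1.} $-h$ is proper and lower semicontinuous; for each $i$, $f_i$ and $g_i$ are locally Lipschitz on an open set containing $S_i$, $f_i\ge 0$ on an open set containing $S_i$, $g_i>0$ on $S_i$, and there are $\alpha_i,\beta_i\ge 0$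 such that for all $x,z\in S_i$: $\big\langle \tfrac{u}{2\sqrt{f_i(x)}},z-x\big\rangle\le\sqrt{f_i(z)}-\sqrt{f_i(x)}+\tfrac{\alpha_i}{2}\|z-x\|^2$ for all $u\in\partial_Lf_i(x)$ whenever $f_i(x)>0$, and $\langle v,z-x\rangle\ge g_i(z)-g_i(x)-\tfrac{\beta_i}{2}\|z-x\|^2$ for all $v\in\partial_Lg_i(x)$. \textbf{Assumption 2.} One of the following holds: (a) $m=1$, $-h+\delta_S$ and $g_1$ are regular on $S$, and $f_1$ is strictly differentiable on an open set containing $S$; (b) $h$ is strictly differentiable on an open set containing $S$, $S$ is regular, and for each $i$, $f_i$ is strictly differentiable on an open set containing $S_i$ and $g_i$ is regular on $S_i$; (c) $h$ is strictly differentiable on an open set containing $S$ and, for each $i$, $f_i$ and $g_i$ are strictly differentiable on an open set containing $S_i$. \textbf{Algorithm 1.} Let $\delta>0$, $\overline\nu\in[0,\delta/2)$, $\mathbf x_{-1}=\mathbf x_0\in S$ with $h(\mathbf x_0)>-\infty$. For $n=0,1,2,\dots$: put $y_{i,n}=\sqrt{f_i(x_{i,n})}/g_i(x_{i,n})$; choose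 $\tau_n\ge\delta+\max_i\tfrac12(2y_{i,n}\alpha_i+y_{i,n}^2\beta_i)$ and $\nu_n\in[0,\overline\nu/\tau_n]$; for each $i$ put $z_{i,n}=x_{i,n}+\nu_n(x_{i,n}-x_{i,n-1})$, choose $u_{i,n}\in\partial_Lf_i(x_{i,n})$, $v_{i,n}\in\partial_Lg_i(x_{i,n})$, put $w_{i,n}=y_{i,n}\frac{u_{i,n}}{\sqrt{f_i(x_{i,n})}}-y_{i,n}^2v_{i,n}$ if $f_i(x_{i,n})>0$ and $w_{i,n}=0$ if $f_i(x_{i,n})=0$; and, successively for $i=1,\dots,m$, choose $$x_{i,n+1}\in\operatorname*{argmax}_{x_i\in S_i}\Big\{h(x_{1,n+1},\dots,x_{i-1,n+1},x_i,x_{i+1,n},\dots,x_{m,n})-\tau_n\big\|x_i-z_{i,n}-\tfrac{1}{2\tau_n}w_{i,n}\big\|^2\Big\}.$$ \textbf{Theorem (Subsequential convergence).} Let $(\mathbf x_n)_{n\in\mathbb N}$ be a sequence generated by Algorithm 1. Suppose that Assumption 1 holds, that $F$ is bounded from above on $S$, and that $\{\mathbf x\in S:F(\mathbf x)\ge F(\mathbf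 x_0)\}$ is bounded. Then: (i) For all $n\in\mathbb N$, $F(\mathbf x_n)-\overline\nu\|\mathbf x_n-\mathbf x_{n-1}\|^2\le F(\mathbf x_{n+1})-(\delta-\overline\nu)\|\mathbf x_{n+1}-\mathbf x_n\|^2$. (ii) The sequence $(F(\mathbf x_n))$ converges to a real number, $(\mathbf x_n)$ is bounded, and $\sum_{n=0}^{\infty}\|\mathbf x_{n+1}-\mathbf x_n\|^2<+\infty$. (iii) Let $\overline{\mathbf x}$ be a cluster point of $(\mathbf x_n)$, and suppose that $\limsup_{n\to\infty}\tau_n<+\infty$ and that either $m=1$ or $h$, as a function into $[-\infty,+\infty]$, is continuous on $S\cap\operatorname{dom}h$, where $\operatorname{dom}h=\{h<+\infty\}$ (so that $S\cap\operatorname{dom}h=S$ under Assumption 1). Then $\lim_{n\to\infty}F(\mathbf x_n)=F(\overline{\mathbf x})$, and $\overline{\mathbf x}\in S$ is a lifted coordinate-wise stationary point. If in addition Assumption 2 holds, then $\overline{\mathbf x}$ is a stationary point. -/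

import Mathlib

open Filter Topology

namespace SumOfRatios

noncomputable section

section Subdifferentials

variable {E : Type*} [NormedAddCommGroup E] [InnerProductSpace ℝ E]

/-- The indicator function of a set: `0` on the set, `+∞` off it. -/
def indicatorFun {X : Type*} (C : Set X) (x : X) : EReal :=
  open Classical in if x ∈ C then 0 else ⊤

/-- The domain `{x | φ x < +∞}` of an extended-real-valued function. -/
def effDom {X : Type*} (φ : X → EReal) : Set X := {x | φ x < ⊤}

/-- Proper: nonempty domain, and the value `-∞` is never taken. -/
def IsProper {X : Type*} (φ : X → EReal) : Prop :=
  (effDom φ).Nonempty ∧ ∀ x, φ x ≠ ⊥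

/-- Fréchet subdifferential (empty at points where `φ` is not finite). -/
def frechetSubdiff (φ : E → EReal) (x : E) : Set E :=
  {u | φ x ≠ ⊥ ∧ φ x ≠ ⊤ ∧
    0 ≤ liminf (fun z : E =>
      (φ z - φ x - ((inner ℝ u (z - x) : ℝ) : EReal)) / ((‖z - x‖ : ℝ) : EReal)) (𝓝[≠] x)}

/-- Limiting subdifferential (empty at points where `φ` is not finite). -/
def limitingSubdiff (φ : E → EReal) (x : E) : Set E :=
  {u | φ x ≠ ⊥ ∧ φ x ≠ ⊤ ∧ ∃ (ξ : ℕ → E) (υ : ℕ → E),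
    Tendsto ξ atTop (𝓝 x) ∧ Tendsto (fun n => φ (ξ n)) atTop (𝓝 (φ x)) ∧
    Tendsto υ atTop (𝓝 u) ∧ ∀ n, υ n ∈ frechetSubdiff φ (ξ n)}

/-- Limiting subdifferential of a real-valued function. -/
def limitingSubdiffReal (φ : E → ℝ) (x : E) : Set E :=
  limitingSubdiff (fun z => (φ z : EReal)) x

/-- Regularity of `φ` at `x`. -/
def RegularAt (φ : E → EReal) (x : E) : Prop :=
  frechetSubdiff φ x = limitingSubdiff φ x

/-- Regularity of `φ` on a set. -/
def RegularOn (φ : E → EReal) (C : Set E) : Prop := ∀ x ∈ C, RegularAt φ x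

/-- A set is regular when its indicator function is regular at all of its points. -/
def RegularSet (C : Set E) : Prop := RegularOn (indicatorFun C) C

/-- Strict differentiability at `x` of an extended-real-valued function: it is finite near `x`
and its real value is strictly differentiable at `x`. -/
def StrictlyDifferentiableAt (φ : E → EReal) (x : E) : Prop :=
  (∀ᶠ z in 𝓝 x, φ z ≠ ⊥ ∧ φ z ≠ ⊤) ∧
    ∃ L : E →L[ℝ] ℝ, HasStrictFDerivAt (fun z => (φ z).toReal) L x

/-- Strict differentiability at every point of some open set containing `C`. -/
def StrictlyDifferentiableNear (φ : E → EReal) (C : Set E) : Prop :=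
  ∃ U : Set E, IsOpen U ∧ C ⊆ U ∧ ∀ x ∈ U, StrictlyDifferentiableAt φ x

end Subdifferentials

section Problem

variable {m : ℕ} {H : Fin m → Type*} [∀ i, NormedAddCommGroup (H i)]
  [∀ i, InnerProductSpace ℝ (H i)]

/-- The feasible set `S = S₁ × ⋯ × Sₘ` in the Hilbert product `H₁ × ⋯ × Hₘ`. -/
def feasible (S : ∀ i, Set (H i)) : Set (PiLp 2 H) := {x | ∀ i, x i ∈ S i}

/-- The objective `F(x) = h(x) + ∑ᵢ fᵢ(xᵢ) / gᵢ(xᵢ)`. -/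
def objective (h : PiLp 2 H → EReal) (f g : ∀ i, H i → ℝ) (x : PiLp 2 H) : EReal :=
  h x + ((∑ i, f i (x i) / g i (x i) : ℝ) : EReal)

/-- The vector `x` with its `i`-th block replaced by `z`. -/
def replaceBlock (x : PiLp 2 H) (i : Fin m) (z : H i) : PiLp 2 H :=
  WithLp.toLp 2 (Function.update (fun j => x j) i z)

/-- The limiting subdifferential of `φ` at `x` with respect to the `i`-th block variable. -/
def partialLimitingSubdiff (φ : PiLp 2 H → EReal) (i : Fin m) (x : PiLp 2 H) : Set (H i) :=
  limitingSubdiff (fun z : H i => φ (replaceBlock x i z)) (x i)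

/-- `x ∈ S` is a stationary point: `0 ∈ ∂_L(-F + δ_S)(x)`. -/
def IsStationaryPoint (S : ∀ i, Set (H i)) (h : PiLp 2 H → EReal) (f g : ∀ i, H i → ℝ)
    (x : PiLp 2 H) : Prop :=
  x ∈ feasible S ∧
    0 ∈ limitingSubdiff (fun y => -objective h f g y + indicatorFun (feasible S) y) x

open scoped Pointwise in
/-- `x ∈ S` is a lifted coordinate-wise stationary point: for each `i`,
`0 ∈ ∂_L^{xᵢ}(-h + δ_S)(x) + (-gᵢ(xᵢ) ∂_L fᵢ(xᵢ) + fᵢ(xᵢ) ∂_L gᵢ(xᵢ)) / gᵢ(xᵢ)²`. -/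
def IsLiftedStationaryPoint (S : ∀ i, Set (H i)) (h : PiLp 2 H → EReal) (f g : ∀ i, H i → ℝ)
    (x : PiLp 2 H) : Prop :=
  x ∈ feasible S ∧ ∀ i,
    0 ∈ partialLimitingSubdiff (fun y => -h y + indicatorFun (feasible S) y) i x +
      (g i (x i) ^ 2)⁻¹ •
        ((-g i (x i)) • limitingSubdiffReal (f i) (x i) +
          f i (x i) • limitingSubdiffReal (g i) (x i))

/-- The standing assumption on the problem, with constants `αᵢ` and `βᵢ`. -/
structure StandingAssumption (S : ∀ i, Set (H i)) (h : PiLp 2 H → EReal) (f g : ∀ i, H i → ℝ)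
    (α β : Fin m → ℝ) : Prop where
  nonempty : ∀ i, (S i).Nonempty
  closed : ∀ i, IsClosed (S i)
  proper : IsProper (fun x => -h x)
  lsc : LowerSemicontinuous (fun x => -h x)
  f_lip : ∀ i, ∃ U : Set (H i), IsOpen U ∧ S i ⊆ U ∧ LocallyLipschitzOn U (f i)
  g_lip : ∀ i, ∃ U : Set (H i), IsOpen U ∧ S i ⊆ U ∧ LocallyLipschitzOn U (g i)
  f_nonneg : ∀ i, ∃ U : Set (H i), IsOpen U ∧ S i ⊆ U ∧ ∀ x ∈ U, 0 ≤ f i x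
  α_nonneg : ∀ i, 0 ≤ α i
  f_ineq : ∀ i, ∀ x ∈ S i, ∀ z ∈ S i, ∀ u ∈ limitingSubdiffReal (f i) x, 0 < f i x →
    inner ℝ ((2 * √(f i x))⁻¹ • u) (z - x) ≤
      √(f i z) - √(f i x) + α i / 2 * ‖z - x‖ ^ 2
  g_pos : ∀ i, ∀ x ∈ S i, 0 < g i x
  β_nonneg : ∀ i, 0 ≤ β i
  g_ineq : ∀ i, ∀ x ∈ S i, ∀ z ∈ S i, ∀ v ∈ limitingSubdiffReal (g i) x,
    g i z - g i x - β i / 2 * ‖z - x‖ ^ 2 ≤ inner ℝ v (z - x)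

/-- The additional assumption, a disjunction of three sets of conditions. -/
def AdditionalAssumption (S : ∀ i, Set (H i)) (h : PiLp 2 H → EReal)
    (f g : ∀ i, H i → ℝ) : Prop :=
  (m = 1 ∧ RegularOn (fun x => -h x + indicatorFun (feasible S) x) (feasible S) ∧
    ∀ i, RegularOn (fun z => (g i z : EReal)) (S i) ∧
      StrictlyDifferentiableNear (fun z => (f i z : EReal)) (S i)) ∨
  (StrictlyDifferentiableNear h (feasible S) ∧ RegularSet (feasible S) ∧
    ∀ i, StrictlyDifferentiableNear (fun z => (f i z : EReal)) (S i) ∧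
      RegularOn (fun z => (g i z : EReal)) (S i)) ∨
  (StrictlyDifferentiableNear h (feasible S) ∧
    ∀ i, StrictlyDifferentiableNear (fun z => (f i z : EReal)) (S i) ∧
      StrictlyDifferentiableNear (fun z => (g i z : EReal)) (S i))

/-- The iterate `x_{n-1}`, with the convention `x_{-1} = x_0`
(which is what truncated subtraction gives at `n = 0`). -/
def prevIterate {X : Type*} (x : ℕ → X) (n : ℕ) : X := x (n - 1)

/-- `y_{i,n} = √(fᵢ(x_{i,n})) / gᵢ(x_{i,n})`. -/
def multiplier (f g : ∀ i, H i → ℝ) (x : ℕ → PiLp 2 H) (n : ℕ) (i : Fin m) : ℝ :=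
  √(f i (x n i)) / g i (x n i)

/-- `z_{i,n} = x_{i,n} + ν_n (x_{i,n} - x_{i,n-1})`. -/
def extrapolated (x : ℕ → PiLp 2 H) (ν : ℕ → ℝ) (n : ℕ) (i : Fin m) : H i :=
  x n i + ν n • (x n i - prevIterate x n i)

/-- `w_{i,n} = y_{i,n} u_{i,n} / √(fᵢ(x_{i,n})) - y_{i,n}² v_{i,n}` if `fᵢ(x_{i,n}) > 0`,
and `0` otherwise. -/
def direction (f g : ∀ i, H i → ℝ) (x u v : ℕ → PiLp 2 H) (n : ℕ) (i : Fin m) : H i :=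
  open Classical in
  if 0 < f i (x n i) then
    (multiplier f g x n i / √(f i (x n i))) • u n i - multiplier f g x n i ^ 2 • v n i
  else 0

/-- `h_{i,n+1}(z) = h(x_{1,n+1}, …, x_{i-1,n+1}, z, x_{i+1,n}, …, x_{m,n})`. -/
def blockFun (h : PiLp 2 H → EReal) (x : ℕ → PiLp 2 H) (n : ℕ) (i : Fin m) (z : H i) : EReal :=
  h (replaceBlock (WithLp.toLp 2 (fun j => if j < i then x (n + 1) j else x n j)) i z)

/-- `x` is a sequence generated by the inertial proximal subgradient method with parameters
`δ`, `νbar`, step data `τ`, `ν` and subgradient choices `u`, `v`. -/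
structure IsGenerated (S : ∀ i, Set (H i)) (h : PiLp 2 H → EReal) (f g : ∀ i, H i → ℝ)
    (α β : Fin m → ℝ) (δ νbar : ℝ) (τ ν : ℕ → ℝ) (u v x : ℕ → PiLp 2 H) : Prop where
  δ_pos : 0 < δ
  νbar_nonneg : 0 ≤ νbar
  νbar_lt : νbar < δ / 2
  init : x 0 ∈ feasible S
  τ_ge : ∀ n i, δ + 1 / 2 * (2 * multiplier f g x n i * α i + multiplier f g x n i ^ 2 * β i) ≤ τ n
  ν_nonneg : ∀ n, 0 ≤ ν n
  ν_le : ∀ n, ν n ≤ νbar / τ n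
  u_mem : ∀ n i, u n i ∈ limitingSubdiffReal (f i) (x n i)
  v_mem : ∀ n i, v n i ∈ limitingSubdiffReal (g i) (x n i)
  step_mem : ∀ n i, x (n + 1) i ∈ S i
  step_max : ∀ n i, IsMaxOn (fun z : H i => blockFun h x n i z -
      ((τ n * ‖z - extrapolated x ν n i - (1 / (2 * τ n)) • direction f g x u v n i‖ ^ 2 : ℝ) :
        EReal)) (S i) (x (n + 1) i)

end Problem

end

end SumOfRatios

open SumOfRatios

namespace SumOfRatios

/-! ### Fréchet and limiting subgradients: epsilon form, closed graph, local bounds. -/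

section Subdifferentials

variable {E : Type*} [NormedAddCommGroup E] [InnerProductSpace ℝ E]

/-! The ratio is linearised by the quadratic transform: `2 * y * √f - y ^ 2 * g ≤ f / g` for every
`y`, with equality at `y = √f / g`. Freezing `y` at the current iterate and inserting the one-sided
quadratic estimates for `√f` and `g` gives a minorant of `f / g` with slope `w` and curvature
absorbed by `τ - δ` (`ratio_minorant`). Comparing each block maximiser with the old block, Young's
inequality for the inertial term and summation over the sweep give (i) (`block_gain_le`,
`h_le_next`). Since `νbar < δ / 2`, the quantity `F (x n) - νbar * ‖x n - x (n - 1)‖ ^ 2` is a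
bounded increasing Lyapunov function, which gives (ii) (`tendsto_and_summable_of_inertial_ascent`).

For (iii), take an ultrafilter along which the iterates tend to the cluster point. Local Lipschitz
bounds make the subgradients converge, and closedness of the limiting graph identifies their limits.
The maximality inequalities then pass to the limit, with a quadratic error, so the limit of the `w`
is even a Fréchet subgradient of each block of `-h + δ_S`; this is lifted stationarity
(`mem_frechetSubdiff_block`).

Under the additional assumption the block subgradients assemble into one of `-h + δ_S`, and the
opposite vector is a Fréchet subgradient of the negated ratios. Full stationarity thus uses only the
elementary inclusion in the Fréchet sum rule (`isStationaryPoint_of_frechet`). -/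

theorem neg_lt_ereal_div_iff {a : EReal} {c t d ε : ℝ} (hd : 0 < d) :
    ((-ε : ℝ) : EReal) < (a - (c : EReal) - (t : EReal)) / (d : EReal) ↔
      (c : EReal) + ((t - ε * d : ℝ) : EReal) < a := by
  induction a with
  | bot =>
    have h1 : ((⊥ : EReal) - (c : EReal) - (t : EReal)) = ⊥ := by simp [sub_eq_add_neg]
    rw [h1, EReal.bot_div_of_pos_ne_top (by exact_mod_cast hd) (EReal.coe_ne_top d)]
    simp
  | top =>
    have h1 : ((⊤ : EReal) - (c : EReal) - (t : EReal)) = ⊤ := by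
      rw [EReal.top_sub_coe, EReal.top_sub_coe]
    rw [h1, EReal.top_div_of_pos_ne_top (by exact_mod_cast hd) (EReal.coe_ne_top d)]
    simp only [EReal.coe_lt_top, true_iff]
    exact_mod_cast EReal.coe_lt_top _
  | coe a =>
    rw [← EReal.coe_sub, ← EReal.coe_sub, ← EReal.coe_div, ← EReal.coe_add, EReal.coe_lt_coe_iff,
      EReal.coe_lt_coe_iff, lt_div_iff₀ hd]
    constructor <;> intro h <;> linarith

/-- Clearing the denominator avoids extended-real quotients; the centre `z = x` can be included
because the inequality is an equality there. -/
theorem mem_frechetSubdiff_iff {φ : E → EReal} {x u : E} :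
    u ∈ frechetSubdiff φ x ↔ φ x ≠ ⊥ ∧ φ x ≠ ⊤ ∧ ∀ ε > (0 : ℝ), ∀ᶠ z in 𝓝 x,
      φ x + ((inner ℝ u (z - x) - ε * ‖z - x‖ : ℝ) : EReal) ≤ φ z := by
  refine and_congr_right fun hb => and_congr_right fun ht => ?_
  lift φ x to ℝ using ⟨ht, hb⟩ with c hc
  rw [le_liminf_iff]
  constructor
  · intro h ε hε
    have h1 := h ((-ε : ℝ) : EReal) (by exact_mod_cast neg_lt_zero.mpr hε)
    rw [eventually_nhdsWithin_iff] at h1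
    filter_upwards [h1] with z hz
    by_cases hzx : z = x
    · subst hzx; simp [← hc]
    · exact ((neg_lt_ereal_div_iff (norm_pos_iff.mpr (sub_ne_zero.mpr hzx))).1 (hz hzx)).le
  · intro h y hy
    obtain ⟨b, hyb, hb0⟩ := EReal.lt_iff_exists_real_btwn.1 hy
    have hb0 : b < 0 := by exact_mod_cast hb0
    rw [eventually_nhdsWithin_iff]
    -- Half of the available slack turns the weak inequality into the strict one required by the
    -- liminf.
    filter_upwards [h (-b / 2) (by linarith)] with z hz hzx
    have hd : 0 < ‖z - x‖ := norm_pos_iff.mpr (sub_ne_zero.mpr hzx)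
    refine hyb.trans ?_
    rw [show b = -(-b) by ring, neg_lt_ereal_div_iff hd]
    refine lt_of_lt_of_le ?_ hz
    norm_cast
    nlinarith

theorem mem_frechetSubdiff_coe_iff {φ : E → ℝ} {x u : E} :
    u ∈ frechetSubdiff (fun z => (φ z : EReal)) x ↔ ∀ ε > (0 : ℝ), ∀ᶠ z in 𝓝 x,
      φ x + inner ℝ u (z - x) - ε * ‖z - x‖ ≤ φ z := by
  rw [mem_frechetSubdiff_iff]
  simp only [ne_eq, EReal.coe_ne_bot, not_false_eq_true, EReal.coe_ne_top, true_and]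
  norm_cast
  simp only [add_sub_assoc]

theorem frechetSubdiff_subset_limitingSubdiff {φ : E → EReal} {x : E} :
    frechetSubdiff φ x ⊆ limitingSubdiff φ x := fun u hu =>
  ⟨hu.1, hu.2.1, fun _ => x, fun _ => u, tendsto_const_nhds, tendsto_const_nhds,
    tendsto_const_nhds, fun _ => hu⟩

theorem exists_frechet_near_of_mem_limitingSubdiff {φ : E → EReal} {x u : E}
    (hu : u ∈ limitingSubdiff φ x) {ε : ℝ} (hε : 0 < ε) :
    ∃ ξ υ : E, dist ξ x < ε ∧ dist υ u < ε ∧ υ ∈ frechetSubdiff φ ξ := by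
  obtain ⟨-, -, ξ, υ, h1, -, h2, h3⟩ := hu
  obtain ⟨n, hn1, hn2⟩ := ((Metric.tendsto_nhds.1 h1 ε hε).and
    (Metric.tendsto_nhds.1 h2 ε hε)).exists
  exact ⟨ξ n, υ n, hn1, hn2, h3 n⟩

/-- Continuity supplies the convergence of values, so it suffices to approximate the point and the
subgradient. This form also makes limits along arbitrary filters accessible. -/
theorem mem_limitingSubdiffReal_of_near {φ : E → ℝ} {x u : E} (hφ : ContinuousAt φ x)
    (h : ∀ ε > (0 : ℝ), ∃ ξ υ : E, dist ξ x < ε ∧ dist υ u < ε ∧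
      υ ∈ frechetSubdiff (fun z => (φ z : EReal)) ξ) :
    u ∈ limitingSubdiffReal φ x := by
  choose! ξ υ h1 h2 h3 using h
  have h0 : Tendsto (fun n : ℕ => 1 / ((n : ℝ) + 1)) atTop (𝓝 0) :=
    tendsto_one_div_add_atTop_nhds_zero_nat
  have hp : ∀ n : ℕ, 0 < 1 / ((n : ℝ) + 1) := fun n => Nat.one_div_pos_of_nat
  have hξ : Tendsto (fun n : ℕ => ξ (1 / ((n : ℝ) + 1))) atTop (𝓝 x) :=
    tendsto_iff_dist_tendsto_zero.2
      (squeeze_zero (fun _ => dist_nonneg) (fun n => (h1 _ (hp n)).le) h0)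
  refine ⟨EReal.coe_ne_bot _, EReal.coe_ne_top _, fun n => ξ (1 / ((n : ℝ) + 1)),
    fun n => υ (1 / ((n : ℝ) + 1)), hξ, ?_, ?_, fun n => h3 _ (hp n)⟩
  · exact (continuous_coe_real_ereal.tendsto _).comp (hφ.tendsto.comp hξ)
  · exact tendsto_iff_dist_tendsto_zero.2
      (squeeze_zero (fun _ => dist_nonneg) (fun n => (h2 _ (hp n)).le) h0)

/-- The graph of the limiting subdifferential is closed at points of continuity. -/
theorem mem_limitingSubdiffReal_of_tendsto {ι : Type*} {l : Filter ι} [l.NeBot] {φ : E → ℝ}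
    {x u : E} {ξ υ : ι → E} (hφ : ContinuousAt φ x) (hξ : Tendsto ξ l (𝓝 x))
    (hυ : Tendsto υ l (𝓝 u)) (h : ∀ n, υ n ∈ limitingSubdiffReal φ (ξ n)) :
    u ∈ limitingSubdiffReal φ x := by
  refine mem_limitingSubdiffReal_of_near hφ fun ε hε => ?_
  obtain ⟨n, hn1, hn2⟩ := ((Metric.tendsto_nhds.1 hξ (ε / 2) (half_pos hε)).and
    (Metric.tendsto_nhds.1 hυ (ε / 2) (half_pos hε))).exists
  obtain ⟨a, b, ha, hb, hab⟩ := exists_frechet_near_of_mem_limitingSubdiff (h n) (half_pos hε)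
  exact ⟨a, b, by linarith [dist_triangle a (ξ n) x], by linarith [dist_triangle b (υ n) u], hab⟩

/-- Test the two inequalities along the ray in direction `u - l`. The alternative `u = l` covers the
case where this direction is zero, as `K` has no sign here. -/
theorem norm_sub_le_of_mem_frechetSubdiff {φ : E → ℝ} {x u l : E} {K : ℝ}
    (hK : ∀ᶠ z in 𝓝 x, φ z - φ x - inner ℝ l (z - x) ≤ K * ‖z - x‖)
    (hu : u ∈ frechetSubdiff (fun z => (φ z : EReal)) x) : ‖u - l‖ ≤ K ∨ u = l := by
  by_cases hul : u = l
  · exact Or.inr hul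
  refine Or.inl (le_of_forall_pos_le_add fun ε hε => ?_)
  have hd : 0 < ‖u - l‖ := norm_pos_iff.mpr (sub_ne_zero.mpr hul)
  have hev := hK.and (mem_frechetSubdiff_coe_iff.1 hu ε hε)
  have ht : Tendsto (fun t : ℝ => x + t • (u - l)) (𝓝[>] 0) (𝓝 x) := by
    have : Continuous (fun t : ℝ => x + t • (u - l)) := by fun_prop
    have h0 := this.tendsto 0
    simp only [zero_smul, add_zero] at h0
    exact h0.mono_left nhdsWithin_le_nhds
  obtain ⟨t, ⟨h1, h2⟩, ht0⟩ := ((ht.eventually hev).and self_mem_nhdsWithin).exists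
  have ht0 : 0 < t := ht0
  simp only [add_sub_cancel_left, inner_smul_right, norm_smul, Real.norm_eq_abs,
    abs_of_pos ht0] at h1 h2
  have h3 : inner ℝ u (u - l) - inner ℝ l (u - l) = ‖u - l‖ ^ 2 := by
    rw [← inner_sub_left, real_inner_self_eq_norm_sq]
  have h4 : t * ‖u - l‖ * ‖u - l‖ ≤ t * ‖u - l‖ * (K + ε) := by nlinarith
  exact le_of_mul_le_mul_left h4 (by positivity)

/-- The estimate is uniform in both points because limiting subgradients come from nearby base
points. Taking `l = 0` gives the Lipschitz bound; taking `l` the gradient and `K` small gives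
uniqueness under strict differentiability. -/
theorem norm_sub_le_of_mem_limitingSubdiffReal {φ : E → ℝ} {x u l : E} {K : ℝ} (hK0 : 0 ≤ K)
    {U : Set E} (hU : U ∈ 𝓝 x)
    (hK : ∀ y ∈ U, ∀ z ∈ U, φ z - φ y - inner ℝ l (z - y) ≤ K * ‖z - y‖)
    (hu : u ∈ limitingSubdiffReal φ x) : ‖u - l‖ ≤ K := by
  obtain ⟨V, hVU, hVo, hxV⟩ := mem_nhds_iff.1 hU
  obtain ⟨ρ, hρ, hball⟩ := Metric.mem_nhds_iff.1 (hVo.mem_nhds hxV)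
  refine le_of_forall_pos_le_add fun ε hε => ?_
  obtain ⟨ξ, υ, h1, h2, h3⟩ := exists_frechet_near_of_mem_limitingSubdiff hu (lt_min hε hρ)
  have hξ : ξ ∈ V := hball (h1.trans_le (min_le_right _ _))
  have h4 : ‖υ - l‖ ≤ K := by
    rcases norm_sub_le_of_mem_frechetSubdiff (l := l) (K := K) (by
      filter_upwards [hVo.mem_nhds hξ] with z hz
      exact hK ξ (hVU hξ) z (hVU hz)) h3 with h | h
    · exact h
    · simpa [h] using hK0
  have h5 : ‖u - υ‖ < ε := by
    rw [← dist_eq_norm, dist_comm]; exact h2.trans_le (min_le_left _ _)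
  calc ‖u - l‖ = ‖(u - υ) + (υ - l)‖ := by congr 1; abel
    _ ≤ ‖u - υ‖ + ‖υ - l‖ := norm_add_le _ _
    _ ≤ K + ε := by linarith

/-- Limiting subgradients of a locally Lipschitz function are locally bounded. -/
theorem exists_bound_limitingSubdiffReal {φ : E → ℝ} {U : Set E} (hU : IsOpen U)
    (hφ : LocallyLipschitzOn U φ) {x : E} (hx : x ∈ U) :
    ∃ K : ℝ, ∀ᶠ y in 𝓝 x, ∀ u ∈ limitingSubdiffReal φ y, ‖u‖ ≤ K := by
  obtain ⟨K, t, ht, hLip⟩ := hφ hx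
  rw [hU.nhdsWithin_eq hx] at ht
  refine ⟨K, ?_⟩
  filter_upwards [eventually_mem_nhds_iff.2 ht] with y hy u hu
  simpa using norm_sub_le_of_mem_limitingSubdiffReal (l := 0) K.2 hy (fun a ha b hb => by
    have := hLip.dist_le_mul b hb a ha
    rw [Real.dist_eq, dist_eq_norm] at this
    simpa using (le_abs_self _).trans this) hu

theorem continuousAt_of_locallyLipschitzOn {E : Type*} [NormedAddCommGroup E] {φ : E → ℝ} {U : Set E} (hU : IsOpen U)
    (hφ : LocallyLipschitzOn U φ) {x : E} (hx : x ∈ U) : ContinuousAt φ x :=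
  (hφ.continuousOn).continuousAt (hU.mem_nhds hx)

theorem zero_mem_limitingSubdiffReal_of_isLocalMin {φ : E → ℝ} {x : E} (h : IsLocalMin φ x) :
    0 ∈ limitingSubdiffReal φ x := by
  refine frechetSubdiff_subset_limitingSubdiff (mem_frechetSubdiff_coe_iff.2 fun ε hε => ?_)
  filter_upwards [h] with z hz
  have : 0 ≤ ε * ‖z - x‖ := by positivity
  rw [inner_zero_left]
  linarith

variable [CompleteSpace E]

/-- At a point of strict differentiability the gradient is the only limiting subgradient. -/
theorem eq_of_mem_limitingSubdiffReal_of_hasStrictFDerivAt {φ : E → ℝ} {x u : E}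
    {L : E →L[ℝ] ℝ} (hL : HasStrictFDerivAt φ L x) (hu : u ∈ limitingSubdiffReal φ x) :
    u = (InnerProductSpace.toDual ℝ E).symm L := by
  rw [← sub_eq_zero, ← norm_le_zero_iff]
  refine le_of_forall_pos_le_add fun ε hε => ?_
  have h1 := hL.isLittleO.def hε
  rw [nhds_prod_eq, eventually_iff, mem_prod_same_iff] at h1
  obtain ⟨t, ht, hsub⟩ := h1
  rw [zero_add]
  refine norm_sub_le_of_mem_limitingSubdiffReal hε.le ht (fun y hy z hz => ?_) hu
  have := hsub (Set.mk_mem_prod hz hy)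
  simp only [Set.mem_ofPred_eq] at this
  rw [InnerProductSpace.toDual_symm_apply]
  exact (le_abs_self _).trans this

theorem mem_frechetSubdiff_of_hasFDerivAt {φ : E → ℝ} {x : E}
    {L : E →L[ℝ] ℝ} (hL : HasFDerivAt φ L x) :
    (InnerProductSpace.toDual ℝ E).symm L ∈ frechetSubdiff (fun z => (φ z : EReal)) x := by
  rw [mem_frechetSubdiff_coe_iff]
  intro ε hε
  filter_upwards [hL.isLittleO.def hε] with z hz
  rw [InnerProductSpace.toDual_symm_apply]
  rw [Real.norm_eq_abs] at hz
  linarith [(abs_le.1 hz).1]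

end Subdifferentials

/-! ### Sum and quotient rules for Fréchet subgradients. -/

section Calculus

variable {E : Type*} [NormedAddCommGroup E] [InnerProductSpace ℝ E]

/-- Sum rule for Fréchet subgradients, one of the functions being real-valued. -/
theorem add_mem_frechetSubdiff {φ : E → EReal} {ψ : E → ℝ} {x a b : E}
    (ha : a ∈ frechetSubdiff φ x) (hb : b ∈ frechetSubdiff (fun z => (ψ z : EReal)) x) :
    a + b ∈ frechetSubdiff (fun z => φ z + (ψ z : EReal)) x := by
  rw [mem_frechetSubdiff_coe_iff] at hb
  rw [mem_frechetSubdiff_iff] at ha ⊢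
  obtain ⟨h1, h2, ha⟩ := ha
  lift φ x to ℝ using ⟨h2, h1⟩ with c hc
  refine ⟨?_, ?_, fun ε hε => ?_⟩
  · exact_mod_cast EReal.coe_ne_bot _
  · exact_mod_cast EReal.coe_ne_top _
  · filter_upwards [ha (ε / 2) (half_pos hε), hb (ε / 2) (half_pos hε)] with z hz1 hz2
    refine le_trans ?_ (add_le_add hz1 (EReal.coe_le_coe_iff.2 hz2))
    norm_cast
    rw [inner_add_left]
    linarith

/-- Quotient rule: a Fréchet subgradient of `-f / g`, with `f` differentiable and nonnegative
and `g` positive. -/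
theorem mem_frechetSubdiff_neg_div {f g : E → ℝ} {x u v : E}
    (hu : ∀ ε > (0 : ℝ), ∀ᶠ z in 𝓝 x, f z ≤ f x + inner ℝ u (z - x) + ε * ‖z - x‖)
    (hv : v ∈ frechetSubdiff (fun z => (g z : EReal)) x) (hg : ContinuousAt g x)
    (hf0 : 0 ≤ f x) (hg0 : 0 < g x) :
    (g x ^ 2)⁻¹ • ((-g x) • u + f x • v) ∈
      frechetSubdiff (fun z => ((-(f z / g z) : ℝ) : EReal)) x := by
  rw [mem_frechetSubdiff_coe_iff] at hv ⊢
  intro ε hε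
  set p := (-g x) • u + f x • v with hp
  set c := (g x ^ 2)⁻¹ with hc
  have hc0 : 0 < c := by positivity
  -- The term `‖p‖` pays for replacing `(g z * g x)⁻¹` by `c`; the other pays for the first-order
  -- errors of `f` and `g`, whose prefactor is at most `2 * c`.
  obtain ⟨η, hη, hηε⟩ : ∃ η > 0, η * (‖p‖ + 2 * c * (g x + f x)) ≤ ε := by
    have hA : 0 ≤ ‖p‖ + 2 * c * (g x + f x) := by positivity
    refine ⟨ε / (‖p‖ + 2 * c * (g x + f x) + 1), by positivity, ?_⟩
    rw [div_mul_eq_mul_div, div_le_iff₀ (by linarith)]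
    nlinarith
  have hlim : Tendsto (fun z => (g z * g x)⁻¹) (𝓝 x) (𝓝 c) := by
    have : Tendsto (fun z => (g z * g x)⁻¹) (𝓝 x) (𝓝 ((g x * g x)⁻¹)) :=
      (hg.tendsto.mul_const _).inv₀ (by positivity)
    simpa [hc, sq] using this
  have hη' : 0 < min η c := lt_min hη hc0
  filter_upwards [hu η hη, hv η hη, hg.eventually (lt_mem_nhds hg0),
    Metric.tendsto_nhds.1 hlim _ hη'] with z h1 h2 h3 h4
  rw [Real.dist_eq] at h4
  obtain ⟨h4a, h4b⟩ := abs_lt.1 h4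
  set q := (g z * g x)⁻¹ with hq
  have hq0 : 0 < q := by positivity
  have hq2 : q ≤ 2 * c := by linarith [min_le_right η c]
  have hqη : |q - c| ≤ η := h4.le.trans (min_le_left _ _)
  have hinner : inner ℝ p (z - x) = -g x * inner ℝ u (z - x) + f x * inner ℝ v (z - x) := by
    rw [hp, inner_add_left, inner_smul_left, inner_smul_left]; simp
  have hN : inner ℝ p (z - x) - η * (g x + f x) * ‖z - x‖ ≤
      -(f z - f x) * g x + f x * (g z - g x) := by
    rw [hinner]; nlinarith
  have hdiff : -(f z / g z) - -(f x / g x) = (-(f z - f x) * g x + f x * (g z - g x)) * q := by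
    rw [hq]; field_simp; ring
  have hip : |inner ℝ p (z - x)| ≤ ‖p‖ * ‖z - x‖ := abs_real_inner_le_norm _ _
  have hqc : -(η * (‖p‖ * ‖z - x‖)) ≤ (q - c) * inner ℝ p (z - x) := by
    have : |(q - c) * inner ℝ p (z - x)| ≤ η * (‖p‖ * ‖z - x‖) := by
      rw [abs_mul]; exact mul_le_mul hqη hip (abs_nonneg _) hη.le
    exact (abs_le.1 this).1
  have hNq := mul_le_mul_of_nonneg_right hN hq0.le
  have hq3 : η * (g x + f x) * ‖z - x‖ * q ≤ η * (g x + f x) * ‖z - x‖ * (2 * c) :=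
    mul_le_mul_of_nonneg_left hq2 (by positivity)
  have hfin := mul_le_mul_of_nonneg_right hηε (norm_nonneg (z - x))
  rw [inner_smul_left]
  simp only [conj_trivial]
  nlinarith

theorem indicatorFun_of_mem {X : Type*} {C : Set X} {x : X} (hx : x ∈ C) :
    indicatorFun C x = 0 := if_pos hx

theorem indicatorFun_of_notMem {X : Type*} {C : Set X} {x : X} (hx : x ∉ C) :
    indicatorFun C x = ⊤ := if_neg hx

end Calculus

/-! ### Block replacement and separable functions on the product. -/

section Product

variable {m : ℕ} {H : Fin m → Type*}

@[simp]
theorem replaceBlock_apply_self (x : PiLp 2 H) (i : Fin m) (z : H i) :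
    replaceBlock x i z i = z := by simp [replaceBlock]

theorem replaceBlock_apply_of_ne (x : PiLp 2 H) {i j : Fin m} (h : j ≠ i) (z : H i) :
    replaceBlock x i z j = x j := by simp [replaceBlock, Function.update_of_ne h]

@[simp]
theorem replaceBlock_self (x : PiLp 2 H) (i : Fin m) : replaceBlock x i (x i) = x := by
  ext j; simp [replaceBlock]

theorem replaceBlock_mem_feasible {S : ∀ i, Set (H i)} {x : PiLp 2 H} (hx : x ∈ feasible S)
    {i : Fin m} {z : H i} : replaceBlock x i z ∈ feasible S ↔ z ∈ S i := by
  constructor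
  · intro h; simpa using h i
  · intro hz j
    by_cases hj : j = i
    · subst hj; simpa using hz
    · rw [replaceBlock_apply_of_ne x hj]; exact hx j

variable [∀ i, NormedAddCommGroup (H i)]

theorem sum_norm_apply_le (x : PiLp 2 H) : ∑ i, ‖x i‖ ≤ m * ‖x‖ := by
  calc ∑ i, ‖x i‖ ≤ ∑ _i : Fin m, ‖x‖ := Finset.sum_le_sum fun i _ => PiLp.norm_apply_le x i
    _ = m * ‖x‖ := by simp

theorem tendsto_apply (x : PiLp 2 H) (i : Fin m) :
    Tendsto (fun y : PiLp 2 H => y i) (𝓝 x) (𝓝 (x i)) :=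
  (PiLp.continuous_apply 2 H i).tendsto x

theorem replaceBlock_sub (x : PiLp 2 H) (i : Fin m) (z : H i) :
    replaceBlock x i z - x = WithLp.toLp 2 (Pi.single i (z - x i)) := by
  ext j
  by_cases hj : j = i
  · subst hj; simp
  · simp [replaceBlock_apply_of_ne x hj, hj]

theorem sum_toLp_single (y : PiLp 2 H) :
    ∑ i, (WithLp.toLp 2 (Pi.single i (y i)) : PiLp 2 H) = y := by
  ext j
  rw [WithLp.ofLp_sum, Finset.sum_apply]
  simp [Finset.sum_pi_single]

theorem norm_replaceBlock_sub (x : PiLp 2 H) (i : Fin m) (z : H i) :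
    ‖replaceBlock x i z - x‖ = ‖z - x i‖ := by
  rw [replaceBlock_sub]
  exact PiLp.norm_single 2 H i (z - x i)

theorem tendsto_replaceBlock (x : PiLp 2 H) (i : Fin m) :
    Tendsto (fun z => replaceBlock x i z) (𝓝 (x i)) (𝓝 x) := by
  rw [tendsto_iff_norm_sub_tendsto_zero]
  simp only [norm_replaceBlock_sub]
  exact tendsto_iff_norm_sub_tendsto_zero.1 tendsto_id

variable [∀ i, InnerProductSpace ℝ (H i)]

/-- Fréchet subgradients of a separable sum. -/
theorem mem_frechetSubdiff_sum {ψ : ∀ i, H i → ℝ} {x a : PiLp 2 H}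
    (ha : ∀ i, a i ∈ frechetSubdiff (fun z => (ψ i z : EReal)) (x i)) :
    a ∈ frechetSubdiff (fun y : PiLp 2 H => ((∑ i, ψ i (y i) : ℝ) : EReal)) x := by
  rw [mem_frechetSubdiff_coe_iff]
  intro ε hε
  -- Each of the `m` block norms is at most the full norm; the `+ 1` covers `m = 0`.
  have hη : 0 < ε / (m + 1) := by positivity
  have h1 : ∀ᶠ y in 𝓝 x, ∀ i, ψ i (x i) + inner ℝ (a i) (y i - x i) -
      ε / (m + 1) * ‖y i - x i‖ ≤ ψ i (y i) :=
    eventually_all.2 fun i =>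
      (tendsto_apply x i).eventually (mem_frechetSubdiff_coe_iff.1 (ha i) _ hη)
  filter_upwards [h1] with y hy
  have h2 := Finset.sum_le_sum fun i (_ : i ∈ Finset.univ) => hy i
  rw [Finset.sum_sub_distrib, Finset.sum_add_distrib, ← Finset.mul_sum] at h2
  have h3 := sum_norm_apply_le (y - x)
  have h4 : ε / (m + 1) * ∑ i, ‖(y - x) i‖ ≤ ε * ‖y - x‖ := by
    calc ε / (m + 1) * ∑ i, ‖(y - x) i‖ ≤ ε / (m + 1) * ((m + 1) * ‖y - x‖) := by
          gcongr; linarith [norm_nonneg (y - x)]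
      _ = ε * ‖y - x‖ := by field_simp
  rw [PiLp.inner_apply]
  simp only [PiLp.sub_apply] at h4 ⊢
  linarith

/-- If `h` is differentiable, blockwise Fréchet subgradients of `-h + δ_S` assemble to a Fréchet
subgradient on the product. -/
theorem mem_frechetSubdiff_of_blocks {S : ∀ i, Set (H i)} {h : PiLp 2 H → EReal}
    {x w : PiLp 2 H} (hx : x ∈ feasible S) (hh : StrictlyDifferentiableAt h x)
    (hw : ∀ i, w i ∈ frechetSubdiff
      (fun z => -h (replaceBlock x i z) + indicatorFun (feasible S) (replaceBlock x i z)) (x i)) :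
    w ∈ frechetSubdiff (fun y => -h y + indicatorFun (feasible S) y) x := by
  obtain ⟨hfin, L, hL⟩ := hh
  have hL := hL.hasFDerivAt
  have hfinx := hfin.self_of_nhds
  set r : PiLp 2 H → ℝ := fun z => (h z).toReal with hr
  have hrx : h x = (r x : EReal) := (EReal.coe_toReal hfinx.2 hfinx.1).symm
  rw [mem_frechetSubdiff_iff]
  refine ⟨?_, ?_, fun ε hε => ?_⟩
  · rw [indicatorFun_of_mem hx, add_zero, hrx]; exact_mod_cast EReal.coe_ne_bot _
  · rw [indicatorFun_of_mem hx, add_zero, hrx]; exact_mod_cast EReal.coe_ne_top _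
  -- Each block loses `2 * η`, once in its subgradient inequality and once in linearising `h`;
  -- linearising `h` on the product loses one more `η`.
  set η := ε / (2 * m + 1) with hηd
  have hη : 0 < η := by positivity
  have hdiff := hL.isLittleO.def hη
  have hblock : ∀ᶠ y in 𝓝 x, ∀ i, y i ∈ S i →
      inner ℝ (w i) (y i - x i) + L (WithLp.toLp 2 (Pi.single i (y i - x i))) ≤
        2 * η * ‖y i - x i‖ := by
    refine eventually_all.2 fun i => (tendsto_apply x i).eventually
      (p := fun z => z ∈ S i → inner ℝ (w i) (z - x i) +
        L (WithLp.toLp 2 (Pi.single i (z - x i))) ≤ 2 * η * ‖z - x i‖) ?_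
    filter_upwards [(mem_frechetSubdiff_iff.1 (hw i)).2.2 η hη,
      (tendsto_replaceBlock x i).eventually hdiff,
      (tendsto_replaceBlock x i).eventually hfin] with z h1 h2 h3 hz
    rw [indicatorFun_of_mem ((replaceBlock_mem_feasible hx).2 hz), replaceBlock_self,
      indicatorFun_of_mem hx, add_zero, add_zero, hrx,
      ← EReal.coe_toReal h3.2 h3.1] at h1
    norm_cast at h1
    rw [norm_replaceBlock_sub, replaceBlock_sub, Real.norm_eq_abs] at h2
    have h4 := (abs_le.1 h2).1
    simp only [hr] at h4 h1
    linarith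
  filter_upwards [hdiff, hblock, hfin] with y h1 h2 h3
  by_cases hy : y ∈ feasible S
  · rw [indicatorFun_of_mem hy, indicatorFun_of_mem hx, add_zero, add_zero, hrx,
      ← EReal.coe_toReal h3.2 h3.1]
    norm_cast
    have h4 := Finset.sum_le_sum fun i (_ : i ∈ Finset.univ) => h2 i (hy i)
    rw [Finset.sum_add_distrib, ← Finset.mul_sum, ← map_sum] at h4
    have h5 := sum_toLp_single (y - x)
    simp only [PiLp.sub_apply] at h5
    rw [h5] at h4
    have h6 := sum_norm_apply_le (y - x)
    simp only [PiLp.sub_apply] at h6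
    have h7 : 2 * η * ∑ i, ‖y i - x i‖ ≤ 2 * η * (m * ‖y - x‖) :=
      mul_le_mul_of_nonneg_left h6 (by positivity)
    have h8 : η * (2 * m + 1) = ε := by rw [hηd]; field_simp
    rw [Real.norm_eq_abs] at h1
    have h9 := (abs_le.1 h1).2
    rw [PiLp.inner_apply]
    simp only [PiLp.sub_apply, hr] at h9 ⊢
    rw [← h8]
    linarith
  · rw [indicatorFun_of_notMem hy, EReal.add_top_of_ne_bot]
    · exact le_top
    · simpa using h3.2

end Product

/-! ### Sufficient ascent of the objective. -/

section Descent

theorem ereal_le_add_of_sub_le_sub {a b : EReal} {A B : ℝ}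
    (h : a - (A : EReal) ≤ b - (B : EReal)) : a ≤ b + ((A - B : ℝ) : EReal) := by
  have h1 : a - (A : EReal) + (A : EReal) ≤ b - (B : EReal) + (A : EReal) := add_le_add_left h _
  rw [EReal.sub_add_cancel] at h1
  refine h1.trans (le_of_eq ?_)
  rw [sub_eq_add_neg, add_assoc]
  norm_cast
  rw [show -B + A = A - B by ring]

/-- The last term does not depend on `y`, so it cancels when two candidates of the same proximal
step are compared. -/
theorem proximal_term_eq {E : Type*} [NormedAddCommGroup E] [InnerProductSpace ℝ E] {τ : ℝ}
    (hτ : τ ≠ 0) (y z w : E) :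
    τ * ‖y - z - (1 / (2 * τ)) • w‖ ^ 2 =
      τ * ‖y - z‖ ^ 2 - inner ℝ w (y - z) + ‖w‖ ^ 2 / (4 * τ) := by
  rw [norm_sub_sq_real, inner_smul_right, norm_smul, mul_pow, real_inner_comm, Real.norm_eq_abs,
    sq_abs]
  field_simp
  ring

/-- If `F` decreases by at most `ν d n` up to a gain of `(δ - ν) d (n + 1)`, and is bounded above,
then it converges, stays above its initial value, and `d` is summable. -/
theorem tendsto_and_summable_of_inertial_ascent {F d : ℕ → ℝ} {δ ν M : ℝ} (hν : 0 ≤ ν)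
    (hνδ : ν < δ / 2) (hd : ∀ n, 0 ≤ d n) (hd0 : d 0 = 0) (hF : ∀ n, F n ≤ M)
    (h : ∀ n, F n - ν * d n ≤ F (n + 1) - (δ - ν) * d (n + 1)) :
    (∃ l, Tendsto F atTop (𝓝 l)) ∧ (∀ n, F 0 ≤ F n) ∧ Summable d := by
  -- Lyapunov sequence: each step gains `(δ - 2 * ν) * d (n + 1)`, and `d 0 = 0` makes it start at
  -- `F 0`.
  set a : ℕ → ℝ := fun n => F n - ν * d n with ha
  have hstep : ∀ n, a n + (δ - 2 * ν) * d (n + 1) ≤ a (n + 1) := fun n => by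
    simp only [ha]; linarith [h n]
  have hpos : 0 < δ - 2 * ν := by linarith
  have hmono : Monotone a := monotone_nat_of_le_succ fun n => by
    have := mul_nonneg hpos.le (hd (n + 1)); linarith [hstep n]
  have haM : ∀ n, a n ≤ M := fun n => by
    have := mul_nonneg hν (hd n); simp only [ha]; linarith [hF n]
  have hsum : ∀ n, (δ - 2 * ν) * ∑ k ∈ Finset.range n, d (k + 1) ≤ a n - a 0 := by
    intro n
    induction n with
    | zero => simp
    | succ n ih => rw [Finset.sum_range_succ]; linarith [hstep n]
  have hs : Summable fun n => d (n + 1) := by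
    refine summable_of_sum_range_le (c := (M - a 0) / (δ - 2 * ν)) (fun n => hd _) fun n => ?_
    rw [le_div_iff₀ hpos]
    linarith [hsum n, haM n]
  have hs' : Summable d := (summable_nat_add_iff 1).1 hs
  refine ⟨⟨⨆ n, a n, ?_⟩, fun n => ?_, hs'⟩
  · have h1 := tendsto_atTop_ciSup hmono ⟨M, by rintro _ ⟨n, rfl⟩; exact haM n⟩
    have h2 := h1.add (hs'.tendsto_atTop_zero.const_mul ν)
    simpa [ha] using h2
  · have h0 := hmono (Nat.zero_le n)
    have := mul_nonneg hν (hd n)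
    simp only [ha, hd0] at h0
    linarith

variable {m : ℕ} {H : Fin m → Type*}

/-- The vector whose first `k` blocks come from `b` and the others from `a`. -/
def hybrid (a b : PiLp 2 H) (k : ℕ) : PiLp 2 H :=
  WithLp.toLp 2 fun j : Fin m => if (j : ℕ) < k then b j else a j

theorem hybrid_zero (a b : PiLp 2 H) : hybrid a b 0 = a := by
  ext j; simp [hybrid]

theorem hybrid_last (a b : PiLp 2 H) : hybrid a b m = b := by
  ext j; simp [hybrid]

theorem hybrid_mem_feasible {S : ∀ i, Set (H i)} {a b : PiLp 2 H} (ha : a ∈ feasible S)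
    (hb : b ∈ feasible S) (k : ℕ) : hybrid a b k ∈ feasible S := by
  intro j
  simp only [hybrid]
  split_ifs
  · exact hb j
  · exact ha j

theorem blockFun_eq (h : PiLp 2 H → EReal) (x : ℕ → PiLp 2 H) (n : ℕ) (i : Fin m) (z : H i) :
    blockFun h x n i z = h (replaceBlock (hybrid (x n) (x (n + 1)) i) i z) := rfl

theorem blockFun_current (h : PiLp 2 H → EReal) (x : ℕ → PiLp 2 H) (n : ℕ) (i : Fin m) :
    blockFun h x n i (x n i) = h (hybrid (x n) (x (n + 1)) i) := by
  rw [blockFun_eq]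
  congr 1
  ext j
  by_cases hj : j = i
  · subst hj; simp [hybrid]
  · rw [replaceBlock_apply_of_ne _ hj]

theorem blockFun_next (h : PiLp 2 H → EReal) (x : ℕ → PiLp 2 H) (n : ℕ) (i : Fin m) :
    blockFun h x n i (x (n + 1) i) = h (hybrid (x n) (x (n + 1)) (i + 1)) := by
  rw [blockFun_eq]
  congr 1
  ext j
  by_cases hj : j = i
  · subst hj; simp [hybrid]
  · rw [replaceBlock_apply_of_ne _ hj]
    have : (j : ℕ) ≠ i := fun hji => hj (Fin.ext hji)
    simp only [hybrid]
    congr 1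
    apply propext
    omega

/-- Blockwise changes of `h` accumulate over a sweep. -/
theorem le_add_sum_of_blockwise (h : PiLp 2 H → EReal) (x : ℕ → PiLp 2 H) (n : ℕ)
    (c : Fin m → ℝ)
    (hc : ∀ i, blockFun h x n i (x n i) ≤ blockFun h x n i (x (n + 1) i) + (c i : EReal)) :
    h (x n) ≤ h (x (n + 1)) + ((∑ i, c i : ℝ) : EReal) := by
  -- Induction on the number of updated blocks, in additive form: differences of values of `h` are
  -- unusable while `-∞` is not excluded.
  have key : ∀ k ≤ m, h (x n) ≤ h (hybrid (x n) (x (n + 1)) k) +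
      ((∑ i with (i : Fin m).val < k, c i : ℝ) : EReal) := by
    intro k
    induction k with
    | zero => intro _; simp [hybrid_zero]
    | succ k ih =>
      intro hk
      have h1 := hc ⟨k, hk⟩
      rw [blockFun_current, blockFun_next] at h1
      have h2 : (Finset.univ.filter fun i : Fin m => i.val < k + 1) =
          insert ⟨k, hk⟩ (Finset.univ.filter fun i : Fin m => i.val < k) := by
        ext j
        simp only [Finset.mem_filter, Finset.mem_univ, true_and, Finset.mem_insert, Fin.ext_iff]
        omega
      rw [h2, Finset.sum_insert (by simp), EReal.coe_add, ← add_assoc]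
      exact (ih (by omega)).trans (add_le_add_left h1 _)
  have := key m le_rfl
  rw [hybrid_last] at this
  simpa using this

variable [∀ i, NormedAddCommGroup (H i)] [∀ i, InnerProductSpace ℝ (H i)]
  {S : ∀ i, Set (H i)} {h : PiLp 2 H → EReal} {f g : ∀ i, H i → ℝ} {α β : Fin m → ℝ}
  {δ νbar : ℝ} {τ ν : ℕ → ℝ} {u v x : ℕ → PiLp 2 H}

theorem IsGenerated.mem_feasible (hgen : IsGenerated S h f g α β δ νbar τ ν u v x) (n : ℕ) :
    x n ∈ feasible S := by
  cases n with
  | zero => exact hgen.init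
  | succ n => exact hgen.step_mem n

theorem StandingAssumption.f_nonneg_of_mem (hst : StandingAssumption S h f g α β) {i : Fin m}
    {z : H i} (hz : z ∈ S i) : 0 ≤ f i z := by
  obtain ⟨U, -, hU, h0⟩ := hst.f_nonneg i
  exact h0 z (hU hz)

theorem StandingAssumption.ne_top (hst : StandingAssumption S h f g α β) (y : PiLp 2 H) :
    h y ≠ ⊤ := by
  intro hy
  exact hst.proper.2 y (by simp [hy])

theorem multiplier_nonneg (hst : StandingAssumption S h f g α β)
    (hgen : IsGenerated S h f g α β δ νbar τ ν u v x) (n : ℕ) (i : Fin m) :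
    0 ≤ multiplier f g x n i :=
  div_nonneg (Real.sqrt_nonneg _) (hst.g_pos i _ (hgen.mem_feasible n i)).le

theorem le_stepsize (hst : StandingAssumption S h f g α β)
    (hgen : IsGenerated S h f g α β δ νbar τ ν u v x) (n : ℕ) (i : Fin m) : δ ≤ τ n := by
  have h1 := multiplier_nonneg hst hgen n i
  have h2 := mul_nonneg h1 (hst.α_nonneg i)
  have h3 := mul_nonneg (sq_nonneg (multiplier f g x n i)) (hst.β_nonneg i)
  linarith [hgen.τ_ge n i]

/-- The proximal step, compared with an arbitrary feasible block. -/
theorem blockFun_le_of_mem (hst : StandingAssumption S h f g α β)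
    (hgen : IsGenerated S h f g α β δ νbar τ ν u v x) (n : ℕ) (i : Fin m) {y : H i}
    (hy : y ∈ S i) :
    blockFun h x n i y ≤ blockFun h x n i (x (n + 1) i) +
      ((τ n * ‖y - extrapolated x ν n i‖ ^ 2 - τ n * ‖x (n + 1) i - extrapolated x ν n i‖ ^ 2 +
        inner ℝ (direction f g x u v n i) (x (n + 1) i - y) : ℝ) : EReal) := by
  have hτ : 0 < τ n := hgen.δ_pos.trans_le (le_stepsize hst hgen n i)
  have h1 := ereal_le_add_of_sub_le_sub (hgen.step_max n i hy)
  rw [proximal_term_eq hτ.ne', proximal_term_eq hτ.ne'] at h1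
  refine h1.trans (le_of_eq ?_)
  congr 2
  have : x (n + 1) i - y = (x (n + 1) i - extrapolated x ν n i) - (y - extrapolated x ν n i) := by
    abel
  rw [this, inner_sub_right _ (x (n + 1) i - extrapolated x ν n i)]
  ring

/-- The linear-quadratic minorant of `fᵢ / gᵢ` at the current iterate. -/
theorem ratio_minorant (hst : StandingAssumption S h f g α β)
    (hgen : IsGenerated S h f g α β δ νbar τ ν u v x) (n : ℕ) (i : Fin m) {z : H i}
    (hz : z ∈ S i) :
    f i (x n i) / g i (x n i) + inner ℝ (direction f g x u v n i) (z - x n i) -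
      (τ n - δ) * ‖z - x n i‖ ^ 2 ≤ f i z / g i z := by
  have hx := hgen.mem_feasible n i
  have hgx := hst.g_pos i _ hx
  have hgz := hst.g_pos i _ hz
  have hfz := hst.f_nonneg_of_mem hz
  have hτ := hgen.τ_ge n i
  have hτδ := le_stepsize hst hgen n i
  unfold direction
  split_ifs with hf
  · set y := multiplier f g x n i with hy
    set s := √(f i (x n i)) with hs
    have hs0 : 0 < s := Real.sqrt_pos.2 hf
    have hs2 : s ^ 2 = f i (x n i) := Real.sq_sqrt hf.le
    have hy0 : 0 ≤ y := multiplier_nonneg hst hgen n i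
    have hyg : y * g i (x n i) = s := by rw [hy, multiplier]; field_simp; rfl
    have hF := hst.f_ineq i _ hx z hz _ (hgen.u_mem n i) hf
    have hG := hst.g_ineq i _ hx z hz _ (hgen.v_mem n i)
    rw [inner_smul_left] at hF
    simp only [conj_trivial] at hF
    rw [inner_sub_left, inner_smul_left, inner_smul_left]
    simp only [conj_trivial]
    -- The quadratic transform, equivalent to `0 ≤ (√f - y * g) ^ 2`; `hfg` is its equality case at
    -- the current iterate.
    have hrat : 2 * y * √(f i z) - y ^ 2 * g i z ≤ f i z / g i z := by
      rw [le_div_iff₀ hgz]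
      have := Real.sq_sqrt hfz
      nlinarith [sq_nonneg (√(f i z) - y * g i z)]
    have hfg : f i (x n i) / g i (x n i) = 2 * y * s - y ^ 2 * g i (x n i) := by
      rw [div_eq_iff hgx.ne', ← hs2, ← hyg]; ring
    have h1 := mul_le_mul_of_nonneg_left hF (mul_nonneg zero_le_two hy0)
    have h2 := mul_le_mul_of_nonneg_left hG (sq_nonneg y)
    have h3 : 2 * y * ((2 * s)⁻¹ * inner ℝ (u n i) (z - x n i)) =
        y / s * inner ℝ (u n i) (z - x n i) := by field_simp
    have h4 := mul_le_mul_of_nonneg_right hτ (sq_nonneg ‖z - x n i‖)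
    rw [h3] at h1
    rw [hfg]
    nlinarith
  · have : f i (x n i) = 0 := le_antisymm (not_lt.1 hf) (hst.f_nonneg_of_mem hx)
    rw [this, inner_zero_left, zero_div]
    have h1 : 0 ≤ f i z / g i z := div_nonneg hfz hgz.le
    have h2 : 0 ≤ (τ n - δ) * ‖z - x n i‖ ^ 2 := mul_nonneg (by linarith) (sq_nonneg _)
    linarith

/-- With `e` the new step and `d` the old one, the `ν n ^ 2 * ‖d‖ ^ 2` terms cancel. The cross term
`2 * τ n * ν n * ⟪e, d⟫` is split by Young's inequality with `τ n * ν n ≤ νbar`, and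
`ratio_minorant` leaves `-δ * ‖e‖ ^ 2` of the proximal term. -/
theorem block_gain_le (hst : StandingAssumption S h f g α β)
    (hgen : IsGenerated S h f g α β δ νbar τ ν u v x) (n : ℕ) (i : Fin m) :
    τ n * ‖x n i - extrapolated x ν n i‖ ^ 2 - τ n * ‖x (n + 1) i - extrapolated x ν n i‖ ^ 2 +
        inner ℝ (direction f g x u v n i) (x (n + 1) i - x n i) ≤
      f i (x (n + 1) i) / g i (x (n + 1) i) - f i (x n i) / g i (x n i) -
        (δ - νbar) * ‖x (n + 1) i - x n i‖ ^ 2 + νbar * ‖x n i - prevIterate x n i‖ ^ 2 := by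
  have hmin := ratio_minorant hst hgen n i (hgen.step_mem n i)
  have hτ : 0 < τ n := hgen.δ_pos.trans_le (le_stepsize hst hgen n i)
  set d := x n i - prevIterate x n i with hd
  set e := x (n + 1) i - x n i with he
  have h1 : x n i - extrapolated x ν n i = -(ν n • d) := by rw [extrapolated]; abel
  have h2 : x (n + 1) i - extrapolated x ν n i = e - ν n • d := by rw [extrapolated, he]; abel
  have hν : τ n * ν n ≤ νbar := by
    have := hgen.ν_le n
    rw [le_div_iff₀ hτ] at this
    linarith
  have hν0 : 0 ≤ τ n * ν n := mul_nonneg hτ.le (hgen.ν_nonneg n)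
  have h3 : 2 * inner ℝ e d ≤ ‖e‖ ^ 2 + ‖d‖ ^ 2 := by
    have := norm_sub_sq_real e d
    nlinarith [sq_nonneg ‖e - d‖]
  have h4 := mul_le_mul_of_nonneg_left h3 hν0
  have h5 := mul_le_mul_of_nonneg_right hν (add_nonneg (sq_nonneg ‖e‖) (sq_nonneg ‖d‖))
  rw [h1, h2, norm_neg, norm_sub_sq_real, inner_smul_right]
  nlinarith

theorem h_le_next (hst : StandingAssumption S h f g α β)
    (hgen : IsGenerated S h f g α β δ νbar τ ν u v x) (n : ℕ) :
    h (x n) ≤ h (x (n + 1)) + ((∑ i, f i (x (n + 1) i) / g i (x (n + 1) i) -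
      ∑ i, f i (x n i) / g i (x n i) - (δ - νbar) * ‖x (n + 1) - x n‖ ^ 2 +
      νbar * ‖x n - prevIterate x n‖ ^ 2 : ℝ) : EReal) := by
  have h1 := le_add_sum_of_blockwise h x n _ fun i =>
    (blockFun_le_of_mem hst hgen n i (hgen.mem_feasible n i)).trans
      (add_le_add_right (EReal.coe_le_coe_iff.2 (block_gain_le hst hgen n i)) _)
  rw [Finset.sum_add_distrib, Finset.sum_sub_distrib, Finset.sum_sub_distrib, ← Finset.mul_sum,
    ← Finset.mul_sum] at h1
  rw [PiLp.norm_sq_eq_of_L2, PiLp.norm_sq_eq_of_L2]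
  exact h1

/-- Adding a real number cannot lift `-∞`, so the ascent inequality propagates finiteness. -/
theorem h_ne_bot (hst : StandingAssumption S h f g α β)
    (hgen : IsGenerated S h f g α β δ νbar τ ν u v x) (hx0 : h (x 0) ≠ ⊥) (n : ℕ) :
    h (x n) ≠ ⊥ := by
  induction n with
  | zero => exact hx0
  | succ n ih =>
    intro hbot
    have := h_le_next hst hgen n
    rw [hbot, EReal.bot_add, le_bot_iff] at this
    exact ih this

theorem objective_eq_coe (hst : StandingAssumption S h f g α β) {y : PiLp 2 H} (hy : h y ≠ ⊥) :
    objective h f g y = (((h y).toReal + ∑ i, f i (y i) / g i (y i) : ℝ) : EReal) := by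
  rw [objective, EReal.coe_add, EReal.coe_toReal (hst.ne_top y) hy]

theorem real_ascent (hst : StandingAssumption S h f g α β)
    (hgen : IsGenerated S h f g α β δ νbar τ ν u v x) (hx0 : h (x 0) ≠ ⊥) (n : ℕ) :
    ((h (x n)).toReal + ∑ i, f i (x n i) / g i (x n i)) - νbar * ‖x n - prevIterate x n‖ ^ 2 ≤
      ((h (x (n + 1))).toReal + ∑ i, f i (x (n + 1) i) / g i (x (n + 1) i)) -
        (δ - νbar) * ‖x (n + 1) - x n‖ ^ 2 := by
  have h1 := h_le_next hst hgen n
  rw [← EReal.coe_toReal (hst.ne_top (x n)) (h_ne_bot hst hgen hx0 n),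
    ← EReal.coe_toReal (hst.ne_top (x (n + 1))) (h_ne_bot hst hgen hx0 (n + 1))] at h1
  norm_cast at h1
  linarith

theorem objective_ascent (hst : StandingAssumption S h f g α β)
    (hgen : IsGenerated S h f g α β δ νbar τ ν u v x) (hx0 : h (x 0) ≠ ⊥) (n : ℕ) :
    objective h f g (x n) - ((νbar * ‖x n - prevIterate x n‖ ^ 2 : ℝ) : EReal) ≤
      objective h f g (x (n + 1)) - (((δ - νbar) * ‖x (n + 1) - x n‖ ^ 2 : ℝ) : EReal) := by
  rw [objective_eq_coe hst (h_ne_bot hst hgen hx0 n),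
    objective_eq_coe hst (h_ne_bot hst hgen hx0 (n + 1))]
  exact_mod_cast real_ascent hst hgen hx0 n

theorem objective_tendsto_and_summable (hst : StandingAssumption S h f g α β)
    (hgen : IsGenerated S h f g α β δ νbar τ ν u v x) (hx0 : h (x 0) ≠ ⊥)
    (hbdd : ∃ M : ℝ, ∀ y ∈ feasible S, objective h f g y ≤ (M : EReal)) :
    (∃ l : ℝ, Tendsto (fun n => (h (x n)).toReal + ∑ i, f i (x n i) / g i (x n i)) atTop (𝓝 l)) ∧
      (∀ n, objective h f g (x 0) ≤ objective h f g (x n)) ∧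
      Summable (fun n => ‖x (n + 1) - x n‖ ^ 2) := by
  obtain ⟨M, hM⟩ := hbdd
  obtain ⟨h1, h2, h3⟩ := tendsto_and_summable_of_inertial_ascent
    (F := fun n => (h (x n)).toReal + ∑ i, f i (x n i) / g i (x n i))
    (d := fun n => ‖x n - prevIterate x n‖ ^ 2) hgen.νbar_nonneg hgen.νbar_lt
    (fun n => sq_nonneg _) (by simp [prevIterate])
    (fun n => by
      have := hM _ (hgen.mem_feasible n)
      rw [objective_eq_coe hst (h_ne_bot hst hgen hx0 n)] at this
      exact_mod_cast this)
    (fun n => real_ascent hst hgen hx0 n)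
  refine ⟨h1, fun n => ?_, (summable_nat_add_iff 1).2 h3⟩
  rw [objective_eq_coe hst (h_ne_bot hst hgen hx0 n), objective_eq_coe hst hx0]
  exact_mod_cast h2 n

end Descent

/-! ### Passage to the limit and stationarity of cluster points. -/

section Limits

/-- Replaces extraction of subsequences: all bounded data converge along the same ultrafilter. -/
theorem exists_tendsto_of_eventually_norm_le {ι E : Type*} [NormedAddCommGroup E] [ProperSpace E]
    (U : Ultrafilter ι) {a : ι → E} {K : ℝ} (h : ∀ᶠ n in (U : Filter ι), ‖a n‖ ≤ K) :
    ∃ b, Tendsto a U (𝓝 b) := by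
  obtain ⟨b, -, hb⟩ := (isCompact_closedBall (0 : E) K).ultrafilter_le_nhds' (U.map a) (by
    rw [Ultrafilter.mem_map]
    filter_upwards [h] with n hn
    simpa using hn)
  exact ⟨b, hb⟩

theorem tendsto_ereal_add_coe {ι : Type*} {l : Filter ι} {a : ι → EReal} {A : EReal} {b : ι → ℝ}
    {B : ℝ} (ha : Tendsto a l (𝓝 A)) (hb : Tendsto b l (𝓝 B)) :
    Tendsto (fun n => a n + (b n : EReal)) l (𝓝 (A + (B : EReal))) :=
  (EReal.continuousAt_add (p := (A, (B : EReal))) (Or.inr (EReal.coe_ne_bot B))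
    (Or.inr (EReal.coe_ne_top B))).tendsto.comp
    (ha.prodMk_nhds ((continuous_coe_real_ereal.tendsto B).comp hb))

variable {m : ℕ} {H : Fin m → Type*}

theorem replaceBlock_congr_of_subsingleton [Subsingleton (Fin m)] (a b : PiLp 2 H) (i : Fin m)
    (z : H i) : replaceBlock a i z = replaceBlock b i z := by
  ext j
  obtain rfl := Subsingleton.elim j i
  simp

variable [∀ i, NormedAddCommGroup (H i)]

theorem tendsto_piLp {ι : Type*} {l : Filter ι} {a : ι → PiLp 2 H} {b : PiLp 2 H}
    (h : ∀ i, Tendsto (fun n => a n i) l (𝓝 (b i))) : Tendsto a l (𝓝 b) :=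
  ((PiLp.continuous_toLp 2 H).tendsto (WithLp.ofLp b)).comp (tendsto_pi_nhds.2 h)

theorem tendsto_hybrid {ι : Type*} {l : Filter ι} {a b : ι → PiLp 2 H} {c : PiLp 2 H}
    (ha : Tendsto a l (𝓝 c)) (hb : Tendsto b l (𝓝 c)) (k : ℕ) :
    Tendsto (fun n => hybrid (a n) (b n) k) l (𝓝 c) := by
  refine tendsto_piLp fun i => ?_
  by_cases hi : (i : ℕ) < k
  · simpa [hybrid, hi, Function.comp_def] using (tendsto_apply c i).comp hb
  · simpa [hybrid, hi, Function.comp_def] using (tendsto_apply c i).comp ha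

theorem tendsto_replaceBlock_const {ι : Type*} {l : Filter ι} {a : ι → PiLp 2 H} {c : PiLp 2 H}
    (ha : Tendsto a l (𝓝 c)) (i : Fin m) (z : H i) :
    Tendsto (fun n => replaceBlock (a n) i z) l (𝓝 (replaceBlock c i z)) := by
  refine tendsto_piLp fun j => ?_
  by_cases hj : j = i
  · subst hj; simp only [replaceBlock_apply_self]; exact tendsto_const_nhds
  · simpa [replaceBlock_apply_of_ne _ hj, Function.comp_def] using (tendsto_apply c j).comp ha

theorem tendsto_next {l : Filter ℕ} {x : ℕ → PiLp 2 H} {xbar : PiLp 2 H} (hl : l ≤ atTop)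
    (hs : Summable (fun n => ‖x (n + 1) - x n‖ ^ 2)) (hx : Tendsto x l (𝓝 xbar)) :
    Tendsto (fun n => x (n + 1)) l (𝓝 xbar) := by
  have h1 : Tendsto (fun n => ‖x (n + 1) - x n‖) atTop (𝓝 0) := by
    simpa using hs.tendsto_atTop_zero.sqrt
  have h2 := (tendsto_zero_iff_norm_tendsto_zero.2 h1).mono_left hl
  simpa using hx.add h2

theorem tendsto_sub_prevIterate {x : ℕ → PiLp 2 H}
    (hs : Summable (fun n => ‖x (n + 1) - x n‖ ^ 2)) :
    Tendsto (fun n => x n - prevIterate x n) atTop (𝓝 0) := by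
  have h1 : Tendsto (fun n => ‖x (n + 1) - x n‖) atTop (𝓝 0) := by
    simpa using hs.tendsto_atTop_zero.sqrt
  exact (tendsto_add_atTop_iff_nat 1).1 (tendsto_zero_iff_norm_tendsto_zero.2 h1)

theorem isClosed_feasible {S : ∀ i, Set (H i)} (hS : ∀ i, IsClosed (S i)) :
    IsClosed (feasible S) := by
  have : feasible S = ⋂ i, (fun x : PiLp 2 H => x i) ⁻¹' S i := by
    ext x; simp [feasible]
  rw [this]
  exact isClosed_iInter fun i => (hS i).preimage (PiLp.continuous_apply 2 H i)

variable [∀ i, InnerProductSpace ℝ (H i)]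
  {S : ∀ i, Set (H i)} {h : PiLp 2 H → EReal} {f g : ∀ i, H i → ℝ} {α β : Fin m → ℝ}
  {δ νbar : ℝ} {τ ν : ℕ → ℝ} {u v x : ℕ → PiLp 2 H}

theorem StandingAssumption.continuousAt_f (hst : StandingAssumption S h f g α β) {i : Fin m}
    {z : H i} (hz : z ∈ S i) : ContinuousAt (f i) z := by
  obtain ⟨U, hU, hSU, hL⟩ := hst.f_lip i
  exact continuousAt_of_locallyLipschitzOn hU hL (hSU hz)

theorem StandingAssumption.continuousAt_g (hst : StandingAssumption S h f g α β) {i : Fin m}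
    {z : H i} (hz : z ∈ S i) : ContinuousAt (g i) z := by
  obtain ⟨U, hU, hSU, hL⟩ := hst.g_lip i
  exact continuousAt_of_locallyLipschitzOn hU hL (hSU hz)

theorem StandingAssumption.tendsto_ratio (hst : StandingAssumption S h f g α β)
    {xbar : PiLp 2 H} (hx : xbar ∈ feasible S) :
    Tendsto (fun y : PiLp 2 H => ∑ i, f i (y i) / g i (y i)) (𝓝 xbar)
      (𝓝 (∑ i, f i (xbar i) / g i (xbar i))) :=
  tendsto_finsetSum _ fun i _ =>
    ((hst.continuousAt_f (hx i)).tendsto.comp (tendsto_apply xbar i)).div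
      ((hst.continuousAt_g (hx i)).tendsto.comp (tendsto_apply xbar i))
      (hst.g_pos i _ (hx i)).ne'

theorem tendsto_extrapolated (hst : StandingAssumption S h f g α β)
    (hgen : IsGenerated S h f g α β δ νbar τ ν u v x) {l : Filter ℕ} (hl : l ≤ atTop)
    {xbar : PiLp 2 H} (hs : Summable (fun n => ‖x (n + 1) - x n‖ ^ 2))
    (hx : Tendsto x l (𝓝 xbar)) (i : Fin m) :
    Tendsto (fun n => extrapolated x ν n i) l (𝓝 (xbar i)) := by
  have h1 : Tendsto (fun n => x n i - prevIterate x n i) l (𝓝 0) :=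
    (tendsto_apply 0 i).comp ((tendsto_sub_prevIterate hs).mono_left hl)
  have h2 : Tendsto (fun n => ν n • (x n i - prevIterate x n i)) l (𝓝 0) := by
    refine squeeze_zero_norm (a := fun n => νbar / δ * ‖x n i - prevIterate x n i‖)
      (fun n => ?_) (by simpa using h1.norm.const_mul (νbar / δ))
    rw [norm_smul, Real.norm_eq_abs, abs_of_nonneg (hgen.ν_nonneg n)]
    refine mul_le_mul_of_nonneg_right ((hgen.ν_le n).trans ?_) (norm_nonneg _)
    exact div_le_div_of_nonneg_left hgen.νbar_nonneg hgen.δ_pos (le_stepsize hst hgen n i)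
  simpa [extrapolated] using ((tendsto_apply xbar i).comp hx).add h2

/-- The direction is a combination of a subgradient of `fᵢ` and one of `gᵢ`, also where `fᵢ`
vanishes: there `0` is a subgradient of `fᵢ`. -/
theorem exists_direction_eq (hst : StandingAssumption S h f g α β)
    (hgen : IsGenerated S h f g α β δ νbar τ ν u v x) (n : ℕ) (i : Fin m) :
    ∃ u' ∈ limitingSubdiffReal (f i) (x n i), direction f g x u v n i =
      -((g i (x n i) ^ 2)⁻¹ • ((-g i (x n i)) • u' + f i (x n i) • v n i)) := by
  have hx := hgen.mem_feasible n i
  have hg := hst.g_pos i _ hx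
  unfold direction
  split_ifs with hf
  · refine ⟨u n i, hgen.u_mem n i, ?_⟩
    have hs : 0 < √(f i (x n i)) := Real.sqrt_pos.2 hf
    have h1 : multiplier f g x n i / √(f i (x n i)) = (g i (x n i) ^ 2)⁻¹ * g i (x n i) := by
      rw [multiplier]; field_simp
    have h2 : multiplier f g x n i ^ 2 = (g i (x n i) ^ 2)⁻¹ * f i (x n i) := by
      rw [multiplier, div_pow, Real.sq_sqrt hf.le]; field_simp
    rw [h1, h2]
    module
  · have h0 : f i (x n i) = 0 := le_antisymm (not_lt.1 hf) (hst.f_nonneg_of_mem hx)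
    refine ⟨0, zero_mem_limitingSubdiffReal_of_isLocalMin ?_, by simp [h0]⟩
    obtain ⟨U, hU, hSU, hnn⟩ := hst.f_nonneg i
    filter_upwards [hU.mem_nhds (hSU hx)] with z hz
    rw [h0]
    exact hnn z hz

theorem exists_tendsto_direction [∀ i, FiniteDimensional ℝ (H i)]
    (hst : StandingAssumption S h f g α β)
    (hgen : IsGenerated S h f g α β δ νbar τ ν u v x) (U : Ultrafilter ℕ)
    {xbar : PiLp 2 H} (hxS : xbar ∈ feasible S) (hx : Tendsto x U (𝓝 xbar)) (i : Fin m) :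
    ∃ ubar ∈ limitingSubdiffReal (f i) (xbar i), ∃ vbar ∈ limitingSubdiffReal (g i) (xbar i),
      Tendsto (fun n => direction f g x u v n i) U
        (𝓝 (-((g i (xbar i) ^ 2)⁻¹ • ((-g i (xbar i)) • ubar + f i (xbar i) • vbar)))) := by
  choose u' hu' hdir using fun n => exists_direction_eq hst hgen n i
  have hxi : Tendsto (fun n => x n i) U (𝓝 (xbar i)) := (tendsto_apply xbar i).comp hx
  have hproper : ProperSpace (H i) := FiniteDimensional.proper_real (H i)
  obtain ⟨ubar, hub⟩ : ∃ b, Tendsto u' U (𝓝 b) := by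
    obtain ⟨V, hV, hSV, hL⟩ := hst.f_lip i
    obtain ⟨K, hK⟩ := exists_bound_limitingSubdiffReal hV hL (hSV (hxS i))
    exact exists_tendsto_of_eventually_norm_le U
      ((hxi.eventually hK).mono fun n hn => hn _ (hu' n))
  obtain ⟨vbar, hvb⟩ : ∃ b, Tendsto (fun n => v n i) U (𝓝 b) := by
    obtain ⟨V, hV, hSV, hL⟩ := hst.g_lip i
    obtain ⟨K, hK⟩ := exists_bound_limitingSubdiffReal hV hL (hSV (hxS i))
    exact exists_tendsto_of_eventually_norm_le U
      ((hxi.eventually hK).mono fun n hn => hn _ (hgen.v_mem n i))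
  refine ⟨ubar, mem_limitingSubdiffReal_of_tendsto (hst.continuousAt_f (hxS i)) hxi hub hu',
    vbar, mem_limitingSubdiffReal_of_tendsto (hst.continuousAt_g (hxS i)) hxi hvb
      (fun n => hgen.v_mem n i), ?_⟩
  have hf := (hst.continuousAt_f (hxS i)).tendsto.comp hxi
  have hg := (hst.continuousAt_g (hxS i)).tendsto.comp hxi
  rw [funext hdir]
  exact (((hg.pow 2).inv₀ (pow_ne_zero 2 (hst.g_pos i _ (hxS i)).ne')).smul
    ((hg.neg.smul hub).add (hf.smul hvb))).neg

/-- The limit of the proximal inequalities along a filter on which all data converge. -/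
theorem le_of_tendsto_blockFun (hst : StandingAssumption S h f g α β)
    (hgen : IsGenerated S h f g α β δ νbar τ ν u v x) {l : Filter ℕ} [l.NeBot] (hl : l ≤ atTop)
    {xbar : PiLp 2 H} (hs : Summable (fun n => ‖x (n + 1) - x n‖ ^ 2))
    (hx : Tendsto x l (𝓝 xbar)) {T : ℝ} (hT : ∀ᶠ n in atTop, τ n ≤ T) {i : Fin m} {w : H i}
    (hw : Tendsto (fun n => direction f g x u v n i) l (𝓝 w)) {y : H i} (hy : y ∈ S i)
    {A B : EReal} (hA : Tendsto (fun n => blockFun h x n i y) l (𝓝 A))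
    (hB : Tendsto (fun n => blockFun h x n i (x (n + 1) i)) l (𝓝 B)) :
    A ≤ B + ((T * ‖y - xbar i‖ ^ 2 + inner ℝ w (xbar i - y) : ℝ) : EReal) := by
  have hz := tendsto_extrapolated hst hgen hl hs hx i
  have hx1 : Tendsto (fun n => x (n + 1) i) l (𝓝 (xbar i)) :=
    (tendsto_apply xbar i).comp (tendsto_next hl hs hx)
  refine le_of_tendsto_of_tendsto hA (tendsto_ereal_add_coe hB
    ((((tendsto_const_nhds (x := y)).sub hz).norm.pow 2).const_mul T |>.add
      (hw.inner (hx1.sub (tendsto_const_nhds (x := y)))))) ?_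
  -- Dropping the nonnegative term at the new iterate and bounding `τ n` by `T` removes any need for
  -- `τ` to converge.
  filter_upwards [hl hT] with n hn
  refine (blockFun_le_of_mem hst hgen n i hy).trans (add_le_add_right ?_ _)
  rw [EReal.coe_le_coe_iff]
  have hτ : 0 ≤ τ n := (hgen.δ_pos.trans_le (le_stepsize hst hgen n i)).le
  have h1 := mul_nonneg hτ (sq_nonneg ‖x (n + 1) i - extrapolated x ν n i‖)
  have h2 := mul_le_mul_of_nonneg_right hn (sq_nonneg ‖y - extrapolated x ν n i‖)
  linarith

/-- A quadratic minorant on a block yields a Fréchet subgradient. -/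
theorem mem_frechetSubdiff_block (hst : StandingAssumption S h f g α β) {xbar : PiLp 2 H}
    (hxS : xbar ∈ feasible S) (hbot : h xbar ≠ ⊥) {i : Fin m} {w : H i} {T : ℝ} (hT : 0 ≤ T)
    (hle : ∀ y ∈ S i, h (replaceBlock xbar i y) ≤
      h xbar + ((T * ‖y - xbar i‖ ^ 2 + inner ℝ w (xbar i - y) : ℝ) : EReal)) :
    w ∈ frechetSubdiff (fun z => -h (replaceBlock xbar i z) +
      indicatorFun (feasible S) (replaceBlock xbar i z)) (xbar i) := by
  have hc := EReal.coe_toReal (hst.ne_top xbar) hbot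
  set c := (h xbar).toReal
  rw [mem_frechetSubdiff_iff]
  simp only [replaceBlock_self, indicatorFun_of_mem hxS, add_zero]
  rw [← hc] at hle ⊢
  refine ⟨by exact_mod_cast EReal.coe_ne_bot _, by exact_mod_cast EReal.coe_ne_top _,
    fun ε hε => ?_⟩
  -- On this ball `T * ‖y - xbar i‖ ^ 2 ≤ ε * ‖y - xbar i‖`; the `+ 1` covers `T = 0`.
  filter_upwards [Metric.ball_mem_nhds (xbar i) (show 0 < ε / (T + 1) by positivity)] with y hy
  by_cases hyS : y ∈ S i
  · rw [indicatorFun_of_mem ((replaceBlock_mem_feasible hxS).2 hyS), add_zero]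
    have h1 := EReal.neg_le_neg_iff.2 (hle y hyS)
    refine le_trans ?_ h1
    norm_cast
    rw [mem_ball_iff_norm, lt_div_iff₀ (by positivity)] at hy
    have h2 : inner ℝ w (xbar i - y) = -inner ℝ w (y - xbar i) := by
      rw [← inner_neg_right, neg_sub]
    rw [h2]
    have h3 := mul_le_mul_of_nonneg_right hy.le (norm_nonneg (y - xbar i))
    nlinarith [sq_nonneg ‖y - xbar i‖]
  · rw [indicatorFun_of_notMem fun hh => hyS ((replaceBlock_mem_feasible hxS).1 hh),
      EReal.add_top_of_ne_bot]
    · exact le_top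
    · exact hst.proper.2 _

/-- With a single block, block subgradients are subgradients. -/
theorem mem_frechetSubdiff_of_subsingleton [Subsingleton (Fin m)] {φ : PiLp 2 H → EReal}
    {xbar w : PiLp 2 H} (i : Fin m)
    (hw : w i ∈ frechetSubdiff (fun z => φ (replaceBlock xbar i z)) (xbar i)) :
    w ∈ frechetSubdiff φ xbar := by
  rw [mem_frechetSubdiff_iff] at hw ⊢
  rw [replaceBlock_self] at hw
  refine ⟨hw.1, hw.2.1, fun ε hε => ?_⟩
  filter_upwards [(tendsto_apply xbar i).eventually (hw.2.2 ε hε)] with y hy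
  have h1 : replaceBlock xbar i (y i) = y := by
    rw [replaceBlock_congr_of_subsingleton xbar y, replaceBlock_self]
  rw [← norm_replaceBlock_sub, h1] at hy
  rw [PiLp.inner_apply, Fintype.sum_subsingleton _ i]
  exact hy

/-- Along a convergent filter, the values of `h` converge and the limit point is feasible with
finite value. -/
theorem tendsto_h_next (hm : 1 ≤ m) (hst : StandingAssumption S h f g α β)
    (hgen : IsGenerated S h f g α β δ νbar τ ν u v x) (hx0 : h (x 0) ≠ ⊥) {l : Filter ℕ}
    [l.NeBot] (hl : l ≤ atTop) {xbar : PiLp 2 H} (hxS : xbar ∈ feasible S)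
    (hs : Summable (fun n => ‖x (n + 1) - x n‖ ^ 2)) (hx : Tendsto x l (𝓝 xbar)) {T : ℝ}
    (hT : ∀ᶠ n in atTop, τ n ≤ T) {w : PiLp 2 H}
    (hw : ∀ i, Tendsto (fun n => direction f g x u v n i) l (𝓝 (w i)))
    (hcont : m = 1 ∨ ContinuousOn h (feasible S ∩ effDom h)) {L : ℝ}
    (hL : Tendsto (fun n => (h (x n)).toReal + ∑ i, f i (x n i) / g i (x n i)) atTop (𝓝 L)) :
    h xbar = ((L - ∑ i, f i (xbar i) / g i (xbar i) : ℝ) : EReal) ∧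
      Tendsto (fun n => h (x (n + 1))) l (𝓝 (h xbar)) := by
  have hx1 := tendsto_next hl hs hx
  -- The objective values converge and the ratios are continuous at `xbar`, so the values of `h`
  -- have a limit; it remains to identify it with `h xbar`.
  have hlim : Tendsto (fun n => h (x (n + 1))) l
      (𝓝 ((L - ∑ i, f i (xbar i) / g i (xbar i) : ℝ) : EReal)) := by
    have h1 := ((tendsto_add_atTop_iff_nat 1).2 hL).mono_left hl
    have h2 := h1.sub ((hst.tendsto_ratio hxS).comp hx1)
    refine ((continuous_coe_real_ereal.tendsto _).comp h2).congr fun n => ?_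
    simp only [Function.comp_apply, add_sub_cancel_right]
    exact EReal.coe_toReal (hst.ne_top _) (h_ne_bot hst hgen hx0 _)
  suffices heq : h xbar = ((L - ∑ i, f i (xbar i) / g i (xbar i) : ℝ) : EReal) from
    ⟨heq, heq ▸ hlim⟩
  rcases hcont with hm1 | hcont
  · have hsub : Subsingleton (Fin m) := by subst hm1; infer_instance
    set i : Fin m := ⟨0, hm⟩
    refine le_antisymm ?_ ?_
    -- Without continuity, the cluster point itself is the competitor: the error term vanishes
    -- there, giving one inequality. Upper semicontinuity of `h` gives the other.
    · have h1 := le_of_tendsto_blockFun (A := h xbar) hst hgen hl hs hx hT (hw i) (hxS i)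
        (by
          refine tendsto_const_nhds.congr fun n => ?_
          rw [blockFun_eq, replaceBlock_congr_of_subsingleton _ xbar, replaceBlock_self])
        (hlim.congr fun n => by
          rw [blockFun_eq, replaceBlock_congr_of_subsingleton _ (x (n + 1)), replaceBlock_self])
      simpa using h1
    · refine le_of_forall_gt_imp_ge_of_dense fun a ha => ?_
      refine le_of_tendsto hlim ?_
      have h1 := hst.lsc xbar (-a) (EReal.neg_lt_neg_iff.2 ha)
      filter_upwards [hx1.eventually h1] with n hn
      exact (EReal.neg_lt_neg_iff.1 hn).le
  · have hdom : feasible S ∩ effDom h = feasible S :=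
      Set.inter_eq_left.2 fun y _ => lt_top_iff_ne_top.2 (hst.ne_top y)
    rw [hdom] at hcont
    exact tendsto_nhds_unique ((hcont xbar hxS).tendsto.comp
      (tendsto_nhdsWithin_iff.2 ⟨hx1, Eventually.of_forall fun n => hgen.mem_feasible _⟩)) hlim

/-- For one block nothing is frozen, so the competitor's value is constant in `n`. Otherwise
continuity carries `h` along the partially updated vectors, which all tend to `xbar`. -/
theorem block_inequality_at_limit (hst : StandingAssumption S h f g α β)
    (hgen : IsGenerated S h f g α β δ νbar τ ν u v x) {l : Filter ℕ}
    [l.NeBot] (hl : l ≤ atTop) {xbar : PiLp 2 H} (hxS : xbar ∈ feasible S)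
    (hs : Summable (fun n => ‖x (n + 1) - x n‖ ^ 2)) (hx : Tendsto x l (𝓝 xbar)) {T : ℝ}
    (hT : ∀ᶠ n in atTop, τ n ≤ T) {i : Fin m} {w : H i}
    (hw : Tendsto (fun n => direction f g x u v n i) l (𝓝 w))
    (hcont : m = 1 ∨ ContinuousOn h (feasible S ∩ effDom h))
    (hh : Tendsto (fun n => h (x (n + 1))) l (𝓝 (h xbar))) {y : H i} (hy : y ∈ S i) :
    h (replaceBlock xbar i y) ≤
      h xbar + ((T * ‖y - xbar i‖ ^ 2 + inner ℝ w (xbar i - y) : ℝ) : EReal) := by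
  have hx1 := tendsto_next hl hs hx
  rcases hcont with hm1 | hcont
  · have hsub : Subsingleton (Fin m) := by subst hm1; infer_instance
    refine le_of_tendsto_blockFun hst hgen hl hs hx hT hw hy
      (tendsto_const_nhds.congr fun n => ?_) (hh.congr fun n => ?_)
    · rw [blockFun_eq, replaceBlock_congr_of_subsingleton xbar]
    · rw [blockFun_eq, replaceBlock_congr_of_subsingleton _ (x (n + 1)), replaceBlock_self]
  · have hdom : feasible S ∩ effDom h = feasible S :=
      Set.inter_eq_left.2 fun y _ => lt_top_iff_ne_top.2 (hst.ne_top y)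
    rw [hdom] at hcont
    have hhyb : ∀ n k, hybrid (x n) (x (n + 1)) k ∈ feasible S := fun n k =>
      hybrid_mem_feasible (hgen.mem_feasible n) (hgen.mem_feasible (n + 1)) k
    refine le_of_tendsto_blockFun hst hgen hl hs hx hT hw hy ?_ ?_
    · exact (hcont _ ((replaceBlock_mem_feasible hxS).2 hy)).tendsto.comp
        (tendsto_nhdsWithin_iff.2 ⟨tendsto_replaceBlock_const (tendsto_hybrid hx hx1 i) i y,
          Eventually.of_forall fun n => (replaceBlock_mem_feasible (hhyb n i)).2 hy⟩)
    · simp only [blockFun_next]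
      exact (hcont xbar hxS).tendsto.comp
        (tendsto_nhdsWithin_iff.2 ⟨tendsto_hybrid hx hx1 _, Eventually.of_forall fun n => hhyb n _⟩)

/-- Sufficient condition for stationarity: Fréchet subgradients of `-h + δ_S` and of the ratios
that cancel. -/
theorem isStationaryPoint_of_frechet {xbar w : PiLp 2 H} (hxS : xbar ∈ feasible S)
    (hw : w ∈ frechetSubdiff (fun y => -h y + indicatorFun (feasible S) y) xbar)
    (hfg : ∀ i, (-w) i ∈ frechetSubdiff (fun z => ((-(f i z / g i z) : ℝ) : EReal)) (xbar i)) :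
    IsStationaryPoint S h f g xbar := by
  refine ⟨hxS, frechetSubdiff_subset_limitingSubdiff ?_⟩
  have h1 := add_mem_frechetSubdiff hw (mem_frechetSubdiff_sum hfg)
  rw [add_neg_cancel] at h1
  refine (congrArg (fun φ => 0 ∈ frechetSubdiff φ xbar) (funext fun y => ?_)).mpr h1
  rw [objective, EReal.neg_add (Or.inr (EReal.coe_ne_top _)) (Or.inr (EReal.coe_ne_bot _)),
    sub_eq_add_neg, add_right_comm, Finset.sum_neg_distrib, EReal.coe_neg]

theorem AdditionalAssumption.strictlyDifferentiableAt_f (hadd : AdditionalAssumption S h f g)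
    {i : Fin m} {z : H i} (hz : z ∈ S i) :
    ∃ L : H i →L[ℝ] ℝ, HasStrictFDerivAt (f i) L z := by
  have : StrictlyDifferentiableNear (fun z => (f i z : EReal)) (S i) := by
    rcases hadd with ⟨-, -, h1⟩ | ⟨-, -, h1⟩ | ⟨-, h1⟩
    · exact (h1 i).2
    · exact (h1 i).1
    · exact (h1 i).1
  obtain ⟨U, -, hSU, hd⟩ := this
  simpa using (hd z (hSU hz)).2

/-- Either regularity says so, or strict differentiability leaves only the gradient, which is a
Fréchet subgradient. -/
theorem AdditionalAssumption.mem_frechetSubdiff_g [∀ i, FiniteDimensional ℝ (H i)]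
    (hadd : AdditionalAssumption S h f g) {i : Fin m} {z b : H i} (hz : z ∈ S i)
    (hb : b ∈ limitingSubdiffReal (g i) z) :
    b ∈ frechetSubdiff (fun z => (g i z : EReal)) z := by
  have hcases : RegularOn (fun z => (g i z : EReal)) (S i) ∨
      StrictlyDifferentiableNear (fun z => (g i z : EReal)) (S i) := by
    rcases hadd with ⟨-, -, h1⟩ | ⟨-, -, h1⟩ | ⟨-, h1⟩
    · exact Or.inl (h1 i).1
    · exact Or.inl (h1 i).2
    · exact Or.inr (h1 i).2
  rcases hcases with hreg | ⟨U, -, hSU, hd⟩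
  · exact (hreg z hz).symm ▸ hb
  · have hcomplete : CompleteSpace (H i) := FiniteDimensional.complete ℝ (H i)
    obtain ⟨L, hL⟩ := (hd z (hSU hz)).2
    simp only [EReal.toReal_coe] at hL
    rw [eq_of_mem_limitingSubdiffReal_of_hasStrictFDerivAt hL hb]
    exact mem_frechetSubdiff_of_hasFDerivAt hL.hasFDerivAt

theorem AdditionalAssumption.mem_frechetSubdiff_of_blocks (hm : 1 ≤ m)
    (hadd : AdditionalAssumption S h f g) {xbar w : PiLp 2 H} (hxS : xbar ∈ feasible S)
    (hw : ∀ i, w i ∈ frechetSubdiff (fun z => -h (replaceBlock xbar i z) +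
      indicatorFun (feasible S) (replaceBlock xbar i z)) (xbar i)) :
    w ∈ frechetSubdiff (fun y => -h y + indicatorFun (feasible S) y) xbar := by
  have hcases : m = 1 ∨ StrictlyDifferentiableNear h (feasible S) := by
    rcases hadd with ⟨h1, -⟩ | ⟨h1, -⟩ | ⟨h1, -⟩
    · exact Or.inl h1
    · exact Or.inr h1
    · exact Or.inr h1
  rcases hcases with hm1 | ⟨U, -, hSU, hd⟩
  · have hsub : Subsingleton (Fin m) := by subst hm1; infer_instance
    exact mem_frechetSubdiff_of_subsingleton
      (φ := fun y => -h y + indicatorFun (feasible S) y) ⟨0, hm⟩ (hw _)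
  · exact SumOfRatios.mem_frechetSubdiff_of_blocks hxS (hd xbar (hSU hxS)) hw

/-- In `-f / g` the numerator needs an upper first-order estimate, supplied by differentiability.
The denominator enters with the nonnegative factor `f / g ^ 2`, so a Fréchet subgradient of `g`
suffices. -/
theorem AdditionalAssumption.mem_frechetSubdiff_ratio [∀ i, FiniteDimensional ℝ (H i)]
    (hst : StandingAssumption S h f g α β) (hadd : AdditionalAssumption S h f g) {i : Fin m}
    {z a b : H i} (hz : z ∈ S i) (ha : a ∈ limitingSubdiffReal (f i) z)
    (hb : b ∈ limitingSubdiffReal (g i) z) :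
    (g i z ^ 2)⁻¹ • ((-g i z) • a + f i z • b) ∈
      frechetSubdiff (fun y => ((-(f i y / g i y) : ℝ) : EReal)) z := by
  have hcomplete : CompleteSpace (H i) := FiniteDimensional.complete ℝ (H i)
  obtain ⟨L, hL⟩ := hadd.strictlyDifferentiableAt_f hz
  refine mem_frechetSubdiff_neg_div (fun ε hε => ?_) (hadd.mem_frechetSubdiff_g hz hb)
    (hst.continuousAt_g hz) (hst.f_nonneg_of_mem hz) (hst.g_pos i z hz)
  rw [eq_of_mem_limitingSubdiffReal_of_hasStrictFDerivAt hL ha]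
  filter_upwards [hL.hasFDerivAt.isLittleO.def hε] with y hy
  rw [InnerProductSpace.toDual_symm_apply]
  rw [Real.norm_eq_abs] at hy
  linarith [(abs_le.1 hy).2]

theorem exists_eventually_le_of_limsup_lt_top
    (h : limsup (fun n => (τ n : EReal)) atTop < ⊤) : ∃ T, 0 ≤ T ∧ ∀ᶠ n in atTop, τ n ≤ T := by
  obtain ⟨T, hT, -⟩ := EReal.lt_iff_exists_real_btwn.1 h
  refine ⟨max T 0, le_max_right _ _, ?_⟩
  filter_upwards [eventually_lt_of_limsup_lt hT] with n hn
  exact le_max_of_le_left (by exact_mod_cast hn.le)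

theorem cluster_point_stationary [∀ i, FiniteDimensional ℝ (H i)] (hm : 1 ≤ m)
    (hst : StandingAssumption S h f g α β)
    (hgen : IsGenerated S h f g α β δ νbar τ ν u v x) (hx0 : h (x 0) ≠ ⊥)
    (hs : Summable (fun n => ‖x (n + 1) - x n‖ ^ 2)) {L : ℝ}
    (hL : Tendsto (fun n => (h (x n)).toReal + ∑ i, f i (x n i) / g i (x n i)) atTop (𝓝 L))
    {xbar : PiLp 2 H} (hclus : MapClusterPt xbar atTop x)
    (hlimsup : limsup (fun n => (τ n : EReal)) atTop < ⊤)
    (hcont : m = 1 ∨ ContinuousOn h (feasible S ∩ effDom h)) :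
    objective h f g xbar = (L : EReal) ∧ IsLiftedStationaryPoint S h f g xbar ∧
      (AdditionalAssumption S h f g → IsStationaryPoint S h f g xbar) := by
  obtain ⟨U, hU, hx⟩ := mapClusterPt_iff_ultrafilter.1 hclus
  obtain ⟨T, hT0, hT⟩ := exists_eventually_le_of_limsup_lt_top hlimsup
  have hxS : xbar ∈ feasible S := (isClosed_feasible hst.closed).mem_of_tendsto hx
    (Eventually.of_forall hgen.mem_feasible)
  choose a ha b hb hab using fun i => exists_tendsto_direction hst hgen U hxS hx i
  -- This one vector is the limit of the directions, and its negative is the quotient-rule vector;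
  -- both stationarity claims are the resulting cancellation.
  set w : PiLp 2 H := WithLp.toLp 2 fun i =>
    -((g i (xbar i) ^ 2)⁻¹ • ((-g i (xbar i)) • a i + f i (xbar i) • b i)) with hw
  obtain ⟨hval, hlim⟩ := tendsto_h_next (w := w) hm hst hgen hx0 hU hxS hs hx hT hab hcont hL
  have hbot : h xbar ≠ ⊥ := by rw [hval]; exact EReal.coe_ne_bot _
  have hblock : ∀ i, w i ∈ frechetSubdiff (fun z => -h (replaceBlock xbar i z) +
      indicatorFun (feasible S) (replaceBlock xbar i z)) (xbar i) := fun i =>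
    mem_frechetSubdiff_block hst hxS hbot hT0 fun y hy =>
      block_inequality_at_limit hst hgen hU hxS hs hx hT (hab i) hcont hlim hy
  refine ⟨?_, ⟨hxS, fun i => ?_⟩, fun hadd => ?_⟩
  · rw [objective, hval, ← EReal.coe_add, sub_add_cancel]
  · refine Set.mem_add.2 ⟨w i, frechetSubdiff_subset_limitingSubdiff (hblock i), _,
      Set.smul_mem_smul_set (Set.add_mem_add (Set.smul_mem_smul_set (ha i))
        (Set.smul_mem_smul_set (hb i))), ?_⟩
    simp [hw]
  · refine isStationaryPoint_of_frechet hxS (hadd.mem_frechetSubdiff_of_blocks hm hxS hblock)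
      fun i => ?_
    have := hadd.mem_frechetSubdiff_ratio hst (hxS i) (ha i) (hb i)
    simpa [hw] using this

end Limits

end SumOfRatios

/-! ### Assembly of the three claims. -/

theorem theorem3p1 {m : ℕ} (hm : 1 ≤ m) {H : Fin m → Type*}
    [∀ i, NormedAddCommGroup (H i)] [∀ i, InnerProductSpace ℝ (H i)]
    [∀ i, FiniteDimensional ℝ (H i)]
    (S : ∀ i, Set (H i)) (h : PiLp 2 H → EReal) (f g : ∀ i, H i → ℝ) (α β : Fin m → ℝ)
    (hstand : StandingAssumption S h f g α β)
    (δ νbar : ℝ) (τ ν : ℕ → ℝ) (u v x : ℕ → PiLp 2 H)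
    (hgen : IsGenerated S h f g α β δ νbar τ ν u v x)
    (hx0 : h (x 0) ≠ ⊥)
    (hbdd : ∃ M : ℝ, ∀ y ∈ feasible S, objective h f g y ≤ (M : EReal))
    (hlevel : Bornology.IsBounded
      {y | y ∈ feasible S ∧ objective h f g (x 0) ≤ objective h f g y}) :
    (∀ n : ℕ,
      objective h f g (x n) - ((νbar * ‖x n - prevIterate x n‖ ^ 2 : ℝ) : EReal) ≤
        objective h f g (x (n + 1)) - (((δ - νbar) * ‖x (n + 1) - x n‖ ^ 2 : ℝ) : EReal)) ∧
    ((∃ l : ℝ, Tendsto (fun n => objective h f g (x n)) atTop (𝓝 (l : EReal))) ∧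
      Bornology.IsBounded (Set.range x) ∧
      Summable (fun n => ‖x (n + 1) - x n‖ ^ 2)) ∧
    (∀ xbar : PiLp 2 H, MapClusterPt xbar atTop x →
      limsup (fun n => (τ n : EReal)) atTop < ⊤ →
      (m = 1 ∨ ContinuousOn h (feasible S ∩ effDom h)) →
      Tendsto (fun n => objective h f g (x n)) atTop (𝓝 (objective h f g xbar)) ∧
      xbar ∈ feasible S ∧
      IsLiftedStationaryPoint S h f g xbar ∧
      (AdditionalAssumption S h f g → IsStationaryPoint S h f g xbar)) := by
  obtain ⟨⟨L, hL⟩, hge, hs⟩ := objective_tendsto_and_summable hstand hgen hx0 hbdd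
  have hF : Tendsto (fun n => objective h f g (x n)) atTop (𝓝 (L : EReal)) :=
    ((continuous_coe_real_ereal.tendsto L).comp hL).congr fun n =>
      (objective_eq_coe hstand (h_ne_bot hstand hgen hx0 n)).symm
  refine ⟨objective_ascent hstand hgen hx0, ⟨⟨L, hF⟩, hlevel.subset ?_, hs⟩,
    fun xbar hclus hlimsup hcont => ?_⟩
  · rintro _ ⟨n, rfl⟩
    exact ⟨hgen.mem_feasible n, hge n⟩
  · obtain ⟨h1, h2, h3⟩ := cluster_point_stationary hm hstand hgen hx0 hs hL hclus hlimsup hcont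
    exact ⟨h1 ▸ hF, h2.1, h2, h3⟩
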